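/- All graphs are finite multigraphs; edge sets are counted with multiplicity (parallel edges are different edges). For a multigraph $G=(V,E)$ and $X\subseteq V$, $G[X]$ is the induced sub-multigraph, $\partial_G(X)$ is the set of edges with one end in $X$ and the other in $V\setminus X$, and for $F\subseteq E$, $\mathbf{End}(F)$ is the set of ends of edges of $F$, $G\setminus F=(V,E\setminus F)$, and $F|_{G[X]}$ is the set of edges of $F$ with both ends in $X$. For a partition $\mathcal P$ of $V$, $\partial_G(\mathcal P)$ is the set of edges whose ends lie in different clusters. For $T'\subseteq T\subseteq V$, a $(T',T\setminus T',t,\beta)$-cut is a bipartition $(X,V\setminus X)$ with $|\partial_G(X)|\le\beta$, $|X|\le t$, $X\cap T=T'$ and $(V\setminus X)\cap T=T\setminus T'$. Let $d\ge c>0$ and $q\ge t>0$ be integers. For $G$ connected and $T\subseteq V$, a set $F\subseteq E$ is an $\mathrm{IA}_G(T,t,q,d,c)$ set if there is a partition $\mathcal P$ of $V$ such that $G[P]$ is connected for every $P\in\mathcal P$, $F=\partial_G(\mathcal P)$, and for every $\emptyset\ne T'\subseteq T$ and every $\alpha\le d$ for which a $(T',T\setminus T',t,d)$-cut of size exactly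 $\alpha$ exists, there is a $(T',T\setminus T',q,\alpha)$-cut $(Y,V\setminus Y)$ such that, for every $P\in\mathcal P$, $G[P]$ contains at most $\max\{\alpha-c,0\}$ edges of $\partial_G(Y)$. For $G$ not necessarily connected, $F\subseteq E$ is an $\mathrm{IA}_G(T,t,q,d,c)$ set if $F|_{G[Q]}$ is an $\mathrm{IA}_{G[Q]}(T\cap Q,t,q,d,c)$ set for the vertex set $Q$ of every connected component of $G$. An $\mathrm{IA}_G(T,t,q',d,c')$ set $F'$ is derived from an $\mathrm{IA}_G(T,t,q,d,c)$ set $F$ if $q'\ge q(d+1)$, $c'>c$, $F\subseteq F'$, and $F'\setminus F$ is an $\mathrm{IA}_{G\setminus F}(T\cup\mathbf{End}(F),\,q,\,q'/(d+1),\,d-c,\,c'-c)$ set. **Lemma.** Let $G_0=(V_0,E_0)$ be a connected multigraph, $T_0\subseteq V_0$, and $V\subseteq V_0$ such that $G=G_0[V]=(V,E)$ is connected. Let $S=\mathbf{End}(\partial_{G_0}(V))\cap V$ and $T=(T_0\cap V)\setminus S$. Let $F$ be an $\mathrm{IA}_{G_0}(T_0,t,q,d,2c)$ set and let $F'$ be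 an $\mathrm{IA}_{G_0}(T_0,t,q',d,2c+1)$ set with $q'\ge 2t$ that is derived from $F$. Then $F'$ has a repair set with respect to $G$ of at most $|S|\,(24c^3+24c^2+4c)$ edges; that is, there is a set $R\subseteq E$ with $|R|\le |S|\,(24c^3+24c^2+4c)$ such that $F'|_G\cup R$ is an $\mathrm{IA}_G(S\cup T,\,t,\,q'+t,\,c,\,1)$ set. -/

import Mathlib

open scoped Graph

namespace Graph

variable {α β : Type*}

/-- A multigraph is connected if it has a vertex and any two vertices are joined by a path. -/
def IsConnected (G : Graph α β) : Prop :=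
  V(G).Nonempty ∧ ∀ x ∈ V(G), ∀ y ∈ V(G), Relation.ReflTransGen G.Adj x y

/-- `X` is the vertex set of a connected component of `G`. -/
def IsComponent (G : Graph α β) (X : Set α) : Prop :=
  X ⊆ V(G) ∧ (G.induce X).IsConnected ∧ ∀ x ∈ X, ∀ y, G.Adj x y → y ∈ X

/-- The cut-set `∂_G(X)` of the cut `(X, V(G) \ X)`: the edges with one end in `X` and the other
end outside `X`. Edges are labelled, so parallel edges count separately. -/
def cutSet (G : Graph α β) (X : Set α) : Set β :=
  {e | ∃ x y, G.IsLink e x y ∧ x ∈ X ∧ y ∉ X}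

/-- `End(F)`: the vertices that are an end of an edge of `F`. -/
def ends (G : Graph α β) (F : Set β) : Set α :=
  {x | ∃ e ∈ F, G.Inc e x}

/-- `𝓠` is a partition of the vertex set of `G`. -/
def IsVertexPartition (G : Graph α β) (𝓠 : Set (Set α)) : Prop :=
  ∅ ∉ 𝓠 ∧ 𝓠.PairwiseDisjoint id ∧ ⋃₀ 𝓠 = V(G)

/-- `∂_G(𝓠)`: the edges of `G` whose ends lie in two different clusters of `𝓠`. -/
def interclusterEdges (G : Graph α β) (𝓠 : Set (Set α)) : Set β :=
  {e | ∃ x y, G.IsLink e x y ∧ ∃ P ∈ 𝓠, ∃ Q ∈ 𝓠, P ≠ Q ∧ x ∈ P ∧ y ∈ Q}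

/-- `(X, V(G) \ X)` is a `(T', T \ T', t, c)`-cut of `G`: it has size at most `c`, the side `X`
has at most `t` vertices, and `X` contains exactly the vertices `T'` of `T`. -/
def IsTerminalCut (G : Graph α β) (T T' : Set α) (t c : ℕ) (X : Set α) : Prop :=
  X ⊆ V(G) ∧ (G.cutSet X).ncard ≤ c ∧ X.ncard ≤ t ∧ T ∩ X = T' ∧ T ∩ (V(G) \ X) = T \ T'

/-- `F` is an `IA_G(T, t, q, d, c)` set, for a connected multigraph `G`.
The truncated difference `a - c` is `max {a - c, 0}`. -/
def IsIASetOfConnected (G : Graph α β) (T : Set α) (t q d c : ℕ) (F : Set β) : Prop :=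
  ∃ 𝓠 : Set (Set α), G.IsVertexPartition 𝓠 ∧ (∀ P ∈ 𝓠, (G.induce P).IsConnected) ∧
    F = G.interclusterEdges 𝓠 ∧
    ∀ T' ⊆ T, T'.Nonempty → ∀ a ≤ d,
      (∃ X, G.IsTerminalCut T T' t d X ∧ (G.cutSet X).ncard = a) →
      ∃ Y, G.IsTerminalCut T T' q a Y ∧
        ∀ P ∈ 𝓠, (G.cutSet Y ∩ E(G.induce P)).ncard ≤ a - c

/-- `F` is an `IA_G(T, t, q, d, c)` set, for a multigraph `G` that need not be connected: the
parameters satisfy `d ≥ c > 0` and `q ≥ t > 0`, and on each connected component of `G` the set `F`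
restricts to an `IA` set. -/
def IsIASet (G : Graph α β) (T : Set α) (t q d c : ℕ) (F : Set β) : Prop :=
  (0 < c ∧ c ≤ d ∧ 0 < t ∧ t ≤ q) ∧ F ⊆ E(G) ∧
    ∀ Q, G.IsComponent Q →
      (G.induce Q).IsIASetOfConnected (T ∩ Q) t q d c (F ∩ E(G.induce Q))

/-- The `IA_G(T, t, q', d, c')` set `F'` is derived from the `IA_G(T, t, q, d, c)` set `F`. A set of
vertices has at most `q' / (d + 1)` elements iff it has at most `⌊q' / (d + 1)⌋` elements. -/
def IsDerivedFrom (G : Graph α β) (T : Set α) (d : ℕ) (q' c' : ℕ) (F' : Set β)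
    (q c : ℕ) (F : Set β) : Prop :=
  q * (d + 1) ≤ q' ∧ c < c' ∧ F ⊆ F' ∧
    (G.deleteEdges F).IsIASet (T ∪ G.ends F) q (q' / (d + 1)) (d - c) (c' - c) (F' \ F)

/-- `S = End(∂_{G₀}(V)) ∩ V`. -/
def boundaryVertices (G₀ : Graph α β) (V : Set α) : Set α :=
  G₀.ends (G₀.cutSet V) ∩ V

/-- `R` is a repair set, with respect to `G = G₀[V]`, of the `IA_{G₀}(T₀, t, q, d, 2c+1)` set `F`:
adding `R` to the restriction of `F` to `G` gives an `IA_G(S ∪ T, t, q + t, c, 1)` set, where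
`S = End(∂_{G₀}(V)) ∩ V` and `T = (T₀ ∩ V) \ S`. -/
def IsRepairSet (G₀ : Graph α β) (T₀ V : Set α) (t q c : ℕ) (F R : Set β) : Prop :=
  R ⊆ E(G₀.induce V) ∧
    (G₀.induce V).IsIASet
      (G₀.boundaryVertices V ∪ ((T₀ ∩ V) \ G₀.boundaryVertices V))
      t (q + t) c 1 ((F ∩ E(G₀.induce V)) ∪ R)

theorem IsConnected.isComponent_iff {G : Graph α β} (hG : G.IsConnected) (Q : Set α) :
    G.IsComponent Q ↔ Q = V(G) := by
  constructor
  · rintro ⟨hQ, ⟨⟨x, hx⟩, -⟩, hcl⟩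
    refine hQ.antisymm fun y hy => ?_
    have h := hG.2 x (hQ hx) y hy
    clear hy
    induction h with
    | refl => exact hx
    | tail _ hab ih => exact hcl _ ih _ hab
  · rintro rfl
    exact ⟨subset_rfl, by simpa using hG, fun x _ y h => h.right_mem⟩

/-- On a connected multigraph the two definitions of `IA` sets agree. -/
theorem IsConnected.isIASet_iff {G : Graph α β} (hG : G.IsConnected) {T : Set α}
    (hT : T ⊆ V(G)) (t q d c : ℕ) (F : Set β) :
    G.IsIASet T t q d c F ↔
      (0 < c ∧ c ≤ d ∧ 0 < t ∧ t ≤ q) ∧ G.IsIASetOfConnected T t q d c F := by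
  unfold IsIASet
  refine and_congr_right fun _ => ?_
  simp only [hG.isComponent_iff, forall_eq, induce_vertexSet, Set.inter_eq_left.2 hT]
  constructor
  · rintro ⟨hF, h⟩
    rwa [Set.inter_eq_left.2 hF] at h
  · intro h
    have hF : F ⊆ E(G) := by
      obtain ⟨𝓠, -, -, rfl, -⟩ := h
      rintro e ⟨x, y, he, -⟩
      exact he.edge_mem
    exact ⟨hF, by rwa [Set.inter_eq_left.2 hF]⟩

end Graph

namespace Graph

variable {α β : Type*} {G G₀ : Graph α β} {A B X Y Z S T K V T₀ : Set α} {Φ Ψ F F' : Set β}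
  {t q q' c d : ℕ} {W : ℕ → Set α} {N l m : ℕ}

/-! ### Cut-sets -/

/-! Let `Φ` be the restriction of `F'` to `G`. The repair is greedy. Suppose some small cut with at
most `c` edges cannot be exchanged for one with the same terminals that is cheaper, meets `Φ`, or is
separated by a cut inside `Φ`; then a cheapest such cut is added to `Φ`. Once no such cut is left,
every cut has an exchange that loses an edge in each cluster, which is the `IA` property with slack
1 (`isIASetOfConnected_of_isImprovable`). Each round adds at most `c` edges, so what remains is to
bound the number of rounds (`IsCutSeq.length_le`).

The greedy sets `W m` are connected and rigid, their cuts are pairwise disjoint, and no cut inside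
the current `Φ` separates the ends of `∂(W m)` (coherence). The set `F` works against them. A set
`D` that avoids `S` has the same cut in `G` and `G₀`. If it has at most `t` vertices and `2c` cut
edges, slack `2c` leaves no edge of the exchanged cut inside a cluster. So `D` has a substitute `Z`
with the same trace on `T` and `∂(Z) ⊆ Φ`, although `Z` may meet `S`
(`IsIASetOfConnected.isReplacing`).

The engine is `IsReplacing.chain_false`. In a long chain `A h` of such sets that agree on `S`,
replace the difference `A j \ A i` of a window of `2c + 1` rings by `Z`. By coherence each `∂(A h)`
lies wholly inside or wholly outside `Z`. Where the side changes, splicing along `Z` gives a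
competitor with cut in `Φ`, and rigidity forces many edges of `∂(Z)` there. Where it does not
change, terminals on the other side force an edge of `∂(Z)` in every ring. Either way `∂(Z)` has
more than `|∂(A i)| + |∂(A j)|` edges, a contradiction.

The rounds are sorted by the trace of `W m` on `S`. If the trace is empty or all of `S`, chains have
at most `3c + 2` members, and unnested sets are charged to different elements of `S` by uncrossing
their substitutes (`IsReplacing.exists_assignment`). If `W m` separates `S`, a component of its
complement that meets `S` is used instead. These branches are cross-free, so they have at most
`4|S|` traces, each shared by at most `2c² + 3c + 2` of them. The sum is `3(3c + 2) + 4(2c² + 3c +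
2) = 8c² + 21c + 14` per element of `S`. -/

theorem IsLink.mem_cutSet_iff {e : β} {x y : α} (h : G.IsLink e x y) :
    e ∈ G.cutSet A ↔ (x ∈ A ∧ y ∉ A) ∨ (x ∉ A ∧ y ∈ A) := by
  constructor
  · rintro ⟨u, v, huv, hu, hv⟩
    rcases h.eq_and_eq_or_eq_and_eq huv with ⟨rfl, rfl⟩ | ⟨rfl, rfl⟩
    · exact Or.inl ⟨hu, hv⟩
    · exact Or.inr ⟨hv, hu⟩
  · rintro (⟨hx, hy⟩ | ⟨hx, hy⟩)
    · exact ⟨x, y, h, hx, hy⟩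
    · exact ⟨y, x, h.symm, hy, hx⟩

theorem cutSet_subset_edgeSet (G : Graph α β) (A : Set α) : G.cutSet A ⊆ E(G) := by
  rintro e ⟨x, y, h, -, -⟩
  exact h.edge_mem

/-- Inclusions between sets of edges may be checked on links. -/
theorem cutSet_subset_of_isLink
    (h : ∀ ⦃e x y⦄, G.IsLink e x y → x ∈ A → y ∉ A → e ∈ Φ) : G.cutSet A ⊆ Φ := by
  rintro e ⟨x, y, hl, hx, hy⟩
  exact h hl hx hy

theorem cutSet_compl (G : Graph α β) (A : Set α) : G.cutSet Aᶜ = G.cutSet A := by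
  ext e
  constructor
  · rintro ⟨x, y, h, hx, hy⟩
    exact ⟨y, x, h.symm, by simpa using hy, hx⟩
  · rintro ⟨x, y, h, hx, hy⟩
    exact ⟨y, x, h.symm, hy, by simpa using hx⟩

theorem cutSet_sdiff_vertexSet (G : Graph α β) (A : Set α) :
    G.cutSet (V(G) \ A) = G.cutSet A := by
  ext e
  constructor
  · rintro ⟨x, y, h, hx, hy⟩
    exact ⟨y, x, h.symm, by_contra fun hy' => hy ⟨h.right_mem, hy'⟩, hx.2⟩
  · rintro ⟨x, y, h, hx, hy⟩
    exact ⟨y, x, h.symm, ⟨h.right_mem, hy⟩, fun h' => h'.2 hx⟩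

theorem cutSet_empty (G : Graph α β) : G.cutSet ∅ = ∅ := by
  ext e
  simp [cutSet]

theorem cutSet_vertexSet (G : Graph α β) : G.cutSet V(G) = ∅ := by
  ext e
  simp only [cutSet, Set.mem_ofPred_eq, Set.mem_empty_iff_false, iff_false]
  rintro ⟨x, y, h, -, hy⟩
  exact hy h.right_mem

theorem cutSet_union_subset (G : Graph α β) (A B : Set α) :
    G.cutSet (A ∪ B) ⊆ G.cutSet A ∪ G.cutSet B := by
  refine cutSet_subset_of_isLink fun e x y h hx hy => ?_
  simp only [Set.mem_union, h.mem_cutSet_iff] at *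
  tauto

theorem cutSet_sdiff_subset (G : Graph α β) (A B : Set α) :
    G.cutSet (A \ B) ⊆ G.cutSet A ∪ G.cutSet B := by
  refine cutSet_subset_of_isLink fun e x y h hx hy => ?_
  simp only [Set.mem_union, Set.mem_sdiff, h.mem_cutSet_iff] at *
  tauto

/-- A finite graph each of whose nontrivial cuts is nonempty. -/
structure IsFinConnected (G : Graph α β) : Prop where
  finite_vertexSet : V(G).Finite
  finite_edgeSet : E(G).Finite
  cutSet_nonempty : ∀ ⦃Q : Set α⦄ ⦃x y⦄, x ∈ V(G) → y ∈ V(G) → x ∈ Q → y ∉ Q →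
    (G.cutSet Q).Nonempty

theorem IsFinConnected.finite_cutSet (hG : G.IsFinConnected) (A : Set α) :
    (G.cutSet A).Finite :=
  hG.finite_edgeSet.subset (cutSet_subset_edgeSet G A)

theorem IsFinConnected.finite_of_subset (hG : G.IsFinConnected) (hA : A ⊆ V(G)) : A.Finite :=
  hG.finite_vertexSet.subset hA

theorem IsFinConnected.exists_isLink (hG : G.IsFinConnected) {x y : α} (hx : x ∈ V(G))
    (hy : y ∈ V(G)) (hxA : x ∈ A) (hyA : y ∉ A) :
    ∃ e u v, G.IsLink e u v ∧ u ∈ A ∧ v ∉ A :=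
  hG.cutSet_nonempty hx hy hxA hyA

theorem IsFinConnected.posimodular (hG : G.IsFinConnected) (A B : Set α) :
    (G.cutSet (A \ B)).ncard + (G.cutSet (B \ A)).ncard
      ≤ (G.cutSet A).ncard + (G.cutSet B).ncard := by
  rw [← Set.ncard_union_add_ncard_inter _ _ (hG.finite_cutSet _) (hG.finite_cutSet _),
    ← Set.ncard_union_add_ncard_inter (G.cutSet A) _ (hG.finite_cutSet _) (hG.finite_cutSet _)]
  refine add_le_add (Set.ncard_le_ncard ?_ ((hG.finite_cutSet _).union (hG.finite_cutSet _)))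
    (Set.ncard_le_ncard ?_ ((hG.finite_cutSet _).inter_of_left _))
  · rintro e (⟨x, y, h, hx, hy⟩ | ⟨x, y, h, hx, hy⟩) <;>
    · simp only [Set.mem_union, Set.mem_sdiff, h.mem_cutSet_iff] at *
      tauto
  · rintro e ⟨⟨x, y, h, hx, hy⟩, h2⟩
    simp only [Set.mem_inter_iff, Set.mem_sdiff, h.mem_cutSet_iff] at *
    tauto

/-! ### Coherence, rigidity and replacement -/

/-- All ends of edges of `∂(A)` lie in `Y`. -/
def CutInside (G : Graph α β) (A Y : Set α) : Prop :=
  ∀ ⦃e x y⦄, G.IsLink e x y → x ∈ A → y ∉ A → x ∈ Y ∧ y ∈ Y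

/-- No cut contained in `Φ` separates the ends of edges of `∂(A)`. -/
def IsCoherent (G : Graph α β) (Φ : Set β) (A : Set α) : Prop :=
  ∀ Y, G.cutSet Y ⊆ Φ → G.CutInside A Y ∨ G.CutInside A Yᶜ

theorem IsCoherent.mono (h : G.IsCoherent Ψ A) (hΦ : Φ ⊆ Ψ) : G.IsCoherent Φ A :=
  fun Y hY => h Y (hY.trans hΦ)

theorem CutInside.of_cutSet_subset (h : G.CutInside A Y) (hAB : G.cutSet B ⊆ G.cutSet A) :
    G.CutInside B Y := by
  intro e x y hl hx hy
  rcases hl.mem_cutSet_iff.1 (hAB (hl.mem_cutSet_iff.2 (Or.inl ⟨hx, hy⟩))) with h' | h'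
  · exact h hl h'.1 h'.2
  · exact (h hl.symm h'.2 h'.1).symm

theorem IsCoherent.of_cutSet_subset (h : G.IsCoherent Φ A) (hAB : G.cutSet B ⊆ G.cutSet A) :
    G.IsCoherent Φ B :=
  fun Y hY => (h Y hY).imp (·.of_cutSet_subset hAB) (·.of_cutSet_subset hAB)

theorem isCoherent_of_cutSet_eq_empty (h : G.cutSet A = ∅) : G.IsCoherent Φ A :=
  fun _ _ => Or.inl fun e _ _ hl hx hy =>
    absurd (h ▸ (hl.mem_cutSet_iff.2 (Or.inl ⟨hx, hy⟩) : e ∈ G.cutSet A)) (Set.notMem_empty e)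

/-- The set `A` of vertices induces a connected graph: it is not split by a set without cutting
an edge. -/
def IsUnsplit (G : Graph α β) (A : Set α) : Prop :=
  ∀ ⦃Y : Set α⦄ ⦃a b : α⦄, a ∈ A → a ∈ Y → b ∈ A → b ∉ Y →
    ∃ e x y, G.IsLink e x y ∧ x ∈ A ∧ y ∈ A ∧ x ∈ Y ∧ y ∉ Y

/-- No set of vertices with the same trace on `K` as `A`, and differing from `A` by at most `r`
vertices in each direction, has a smaller cut-set, or one of the same size that meets `Φ`. -/
def IsRigid (G : Graph α β) (K : Set α) (r : ℕ) (Φ : Set β) (A : Set α) : Prop :=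
  ∀ B ⊆ V(G), B ∩ K = A ∩ K → (B \ A).ncard ≤ r → (A \ B).ncard ≤ r →
    (G.cutSet B).ncard ≤ (G.cutSet A).ncard →
      (G.cutSet B).ncard = (G.cutSet A).ncard ∧ Disjoint (G.cutSet B) Φ

theorem IsRigid.mono {r : ℕ} (h : G.IsRigid K r Ψ A) (hΦ : Φ ⊆ Ψ) : G.IsRigid K r Φ A :=
  fun B h1 h2 h3 h4 h5 => (h B h1 h2 h3 h4 h5).imp_right fun h => h.mono_right hΦ

/-- A competitor with cut in `Φ` that is no larger would be disjoint from `Φ`, hence have an empty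
cut, against equality of sizes. In this form rigidity is played against the cuts supplied by
`IsReplacing`. -/
theorem IsRigid.ncard_lt (hG : G.IsFinConnected) {r : ℕ} (h : G.IsRigid K r Φ A)
    (hA : (G.cutSet A).Nonempty) (hB : B ⊆ V(G)) (hK : B ∩ K = A ∩ K)
    (h1 : (B \ A).ncard ≤ r) (h2 : (A \ B).ncard ≤ r) (hΦ : G.cutSet B ⊆ Φ) :
    (G.cutSet A).ncard < (G.cutSet B).ncard := by
  by_contra hlt
  obtain ⟨heq, hd⟩ := h B hB hK h1 h2 (not_lt.1 hlt)
  have h0 : G.cutSet B = ∅ := Set.subset_empty_iff.1 (hd subset_rfl hΦ)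
  rw [h0, Set.ncard_empty] at heq
  exact hA.ne_empty ((Set.ncard_eq_zero (hG.finite_cutSet _)).1 heq.symm)

/-- A union of components of the complement of a rigid set is rigid. -/
theorem IsRigid.of_closed (hG : G.IsFinConnected) {r : ℕ} {W N : Set α} (h : G.IsRigid K r Φ W)
    (hW : W ⊆ V(G)) (hN : N ⊆ V(G) \ W)
    (hcl : ∀ ⦃e x y⦄, G.IsLink e x y → x ∈ N → y ∉ N → y ∈ W) : G.IsRigid K r Φ N := by
  intro B hB hK h1 h2 hle
  -- `∂(W)` is the disjoint union of `∂(N)` and `∂(N')`. So a competitor `B` for `N` yields the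
  -- competitor `V(G) \ (B ∪ N')` for `W`, the two differences changing places.
  set N' := (V(G) \ W) \ N with hN'
  have hNW : ∀ x ∈ N, x ∈ V(G) ∧ x ∉ W := fun x hx => hN hx
  have hWeq : G.cutSet W = G.cutSet N ∪ G.cutSet N' := by
    ext e
    constructor
    · rintro ⟨x, y, hl, hx, hy⟩
      have := hl.left_mem
      have := hl.right_mem
      simp only [Set.mem_union, hl.mem_cutSet_iff, hN', Set.mem_sdiff]
      have := hNW x
      tauto
    · rintro (⟨x, y, hl, hx, hy⟩ | ⟨x, y, hl, hx, hy⟩)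
      · exact ⟨y, x, hl.symm, hcl hl hx hy, (hNW x hx).2⟩
      · simp only [hN', Set.mem_sdiff] at hx hy
        have h1 := hl.right_mem
        have h2 := @hcl e y x hl.symm
        rw [hl.mem_cutSet_iff]
        tauto
  have hdis : Disjoint (G.cutSet N) (G.cutSet N') := by
    rw [Set.disjoint_left]
    rintro e ⟨x, y, hl, hx, hy⟩ h'
    have h1 := hcl hl hx hy
    simp only [hl.mem_cutSet_iff, hN', Set.mem_sdiff] at h'
    tauto
  have hWcard : (G.cutSet W).ncard = (G.cutSet N).ncard + (G.cutSet N').ncard := by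
    rw [hWeq, Set.ncard_union_eq hdis (hG.finite_cutSet _) (hG.finite_cutSet _)]
  have hBsub : G.cutSet (V(G) \ (B ∪ N')) ⊆ G.cutSet B ∪ G.cutSet N' := by
    rw [cutSet_sdiff_vertexSet]
    exact cutSet_union_subset _ _ _
  have hBfin := (hG.finite_cutSet B).union (hG.finite_cutSet N')
  have hBle : (G.cutSet (V(G) \ (B ∪ N'))).ncard ≤ (G.cutSet B).ncard + (G.cutSet N').ncard :=
    (Set.ncard_le_ncard hBsub hBfin).trans (Set.ncard_union_le _ _)
  have hK' : ∀ x ∈ K, x ∈ B ↔ x ∈ N := fun x hx => by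
    have := Set.ext_iff.1 hK x
    simpa [hx] using this
  obtain ⟨heq, hd⟩ := h (V(G) \ (B ∪ N')) Set.sdiff_subset
    (by
      ext x
      have := hK' x
      have := hNW x
      have := @hW x
      simp only [hN', Set.mem_inter_iff, Set.mem_sdiff, Set.mem_union]
      tauto)
    ((Set.ncard_le_ncard (by
      intro x
      simp only [hN', Set.mem_sdiff, Set.mem_union]
      tauto) (hG.finite_of_subset (Set.sdiff_subset.trans (hN.trans Set.sdiff_subset)))).trans h2)
    ((Set.ncard_le_ncard (by
      intro x
      have := hNW x
      have := @hW x
      simp only [hN', Set.mem_sdiff, Set.mem_union]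
      tauto) (hG.finite_of_subset (Set.sdiff_subset.trans hB))).trans h1)
    (by omega)
  have hBN : (G.cutSet B).ncard = (G.cutSet N).ncard := by omega
  -- Equality of sizes makes `∂(B)` part of the competitor's cut, so disjointness from `Φ` descends
  -- to it.
  have hEq : G.cutSet (V(G) \ (B ∪ N')) = G.cutSet B ∪ G.cutSet N' :=
    Set.eq_of_subset_of_ncard_le hBsub (by
      have := Set.ncard_union_le (G.cutSet B) (G.cutSet N')
      omega) hBfin
  rw [hEq] at hd
  exact ⟨hBN, hd.mono_left Set.subset_union_left⟩

/-- Small sets of vertices that avoid `S`, meet `T` and have at most `2c` cut edges can be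
replaced, as far as `T` is concerned, by sets whose cut-set is contained in `Φ`. -/
def IsReplacing (G : Graph α β) (S T : Set α) (t q c : ℕ) (Φ : Set β) : Prop :=
  ∀ D ⊆ V(G), Disjoint D S → D.ncard ≤ t → (G.cutSet D).ncard ≤ 2 * c → (D ∩ T).Nonempty →
    ∃ Z ⊆ V(G), Z ∩ T = D ∩ T ∧ Z.ncard ≤ q ∧ G.cutSet Z ⊆ Φ ∧
      (G.cutSet Z).ncard ≤ (G.cutSet D).ncard

/-! ### Chains of cuts -/

/-- The edges of `∂(Z)` with both ends in `M`. -/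
def innerCut (G : Graph α β) (Z M : Set α) : Set β :=
  G.cutSet Z ∩ E(G.induce M)

theorem IsLink.mem_innerCut {e : β} {x y : α} {M : Set α} (h : G.IsLink e x y) (hx : x ∈ M)
    (hy : y ∈ M) (hxZ : x ∈ Z) (hyZ : y ∉ Z) : e ∈ G.innerCut Z M :=
  ⟨h.mem_cutSet_iff.2 (Or.inl ⟨hxZ, hyZ⟩), ⟨x, y, h, hx, hy⟩⟩

theorem innerCut_compl (G : Graph α β) (Z M : Set α) : G.innerCut Zᶜ M = G.innerCut Z M := by
  rw [innerCut, cutSet_compl, innerCut]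

theorem IsFinConnected.finite_innerCut (hG : G.IsFinConnected) (Z M : Set α) :
    (G.innerCut Z M).Finite :=
  (hG.finite_cutSet Z).subset Set.inter_subset_left

theorem innerCut_mono {M N : Set α} (h : M ⊆ N) : G.innerCut Z M ⊆ G.innerCut Z N := by
  rintro e ⟨he, x, y, hl, hx, hy⟩
  exact ⟨he, x, y, hl, h hx, h hy⟩

theorem disjoint_innerCut {M N : Set α} (h : Disjoint M N) :
    Disjoint (G.innerCut Z M) (G.innerCut Z N) := by
  rw [Set.disjoint_left] at h ⊢
  rintro e ⟨-, x, y, hl, hx, hy⟩ ⟨-, x', y', hl', hx', hy'⟩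
  rcases hl.eq_and_eq_or_eq_and_eq hl' with ⟨rfl, rfl⟩ | ⟨rfl, rfl⟩
  · exact h hx hx'
  · exact h hx hy'

theorem IsFinConnected.ncard_innerCut_add_le (hG : G.IsFinConnected) {A₁ A₂ A₃ : Set α}
    (h₁ : A₁ ⊆ A₂) (h₂ : A₂ ⊆ A₃) :
    (G.innerCut Z (A₂ \ A₁)).ncard + (G.innerCut Z (A₃ \ A₂)).ncard
      ≤ (G.innerCut Z (A₃ \ A₁)).ncard := by
  rw [← Set.ncard_union_eq _ (hG.finite_innerCut _ _) (hG.finite_innerCut _ _)]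
  · refine Set.ncard_le_ncard (Set.union_subset (innerCut_mono ?_) (innerCut_mono ?_))
      (hG.finite_innerCut _ _)
    · exact Set.sdiff_subset_sdiff_left h₂
    · exact Set.sdiff_subset_sdiff_right h₁
  · exact disjoint_innerCut (Set.disjoint_left.2 fun x hx hx' => hx'.2 hx.1)

/-- Splicing: as `∂(A)` lies inside `Z` and `∂(B)` outside, following `Z` through the ring `B \ A`
cuts only edges of `∂(Z)`. An edge leaving the ring would have to lie in both cuts. -/
theorem cutSet_union_inter_subset (hAB : A ⊆ B) (hd : Disjoint (G.cutSet A) (G.cutSet B))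
    (hA : G.CutInside A Z) (hB : G.CutInside B Zᶜ) :
    G.cutSet (A ∪ (B \ A) ∩ Z) ⊆ G.innerCut Z (B \ A) := by
  refine cutSet_subset_of_isLink fun e x y hl hx hy => ?_
  have hd' : ¬(e ∈ G.cutSet A ∧ e ∈ G.cutSet B) := fun h => Set.disjoint_left.1 hd h.1 h.2
  rw [hl.mem_cutSet_iff, hl.mem_cutSet_iff] at hd'
  have h1 := @hA e x y hl
  have h2 := @hB e x y hl
  have h3 := @hAB x
  have h4 := @hAB y
  simp only [Set.mem_union, Set.mem_inter_iff, Set.mem_sdiff, Set.mem_compl_iff] at hx hy h2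
  refine hl.mem_innerCut ⟨?_, ?_⟩ ⟨?_, ?_⟩ ?_ ?_ <;> tauto

theorem cutSet_union_sdiff_subset (hAB : A ⊆ B) (hd : Disjoint (G.cutSet A) (G.cutSet B))
    (hA : G.CutInside A Zᶜ) (hB : G.CutInside B Z) :
    G.cutSet (A ∪ (B \ A) \ Z) ⊆ G.innerCut Z (B \ A) := by
  have := cutSet_union_inter_subset (Z := Zᶜ) hAB hd hA (by rwa [compl_compl])
  rwa [innerCut_compl] at this

/-- By connectivity some edge leaves `(B \ A) ∩ Z`. It is in neither `∂(A)` nor `∂(B)`, whose ends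
avoid `Z`, so it crosses `∂(Z)` within the ring. -/
theorem IsFinConnected.innerCut_nonempty (hG : G.IsFinConnected) (hA : G.CutInside A Zᶜ)
    (hB : G.CutInside B Zᶜ) {u v : α} (hv : v ∈ B \ A) (hvZ : v ∈ Z) (hvV : v ∈ V(G))
    (hu : u ∈ V(G)) (huZ : u ∉ Z) : (G.innerCut Z (B \ A)).Nonempty := by
  obtain ⟨e, x, y, hl, hx, hy⟩ :=
    hG.exists_isLink (A := (B \ A) ∩ Z) hvV hu ⟨hv, hvZ⟩ (fun h => huZ h.2)
  refine ⟨e, ?_⟩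
  have h1 := @hA e x y hl
  have h2 := @hB e x y hl
  have h3 := @hA e y x hl.symm
  have h4 := @hB e y x hl.symm
  simp only [Set.mem_inter_iff, Set.mem_sdiff, Set.mem_compl_iff] at hx hy h1 h2 h3 h4
  refine hl.mem_innerCut ⟨?_, ?_⟩ ⟨?_, ?_⟩ ?_ ?_ <;> tauto

theorem IsFinConnected.innerCut_nonempty' (hG : G.IsFinConnected) (hA : G.CutInside A Z)
    (hB : G.CutInside B Z) {u v : α} (hv : v ∈ B \ A) (hvZ : v ∉ Z) (hvV : v ∈ V(G))
    (hu : u ∈ V(G)) (huZ : u ∈ Z) : (G.innerCut Z (B \ A)).Nonempty := by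
  rw [← innerCut_compl]
  exact hG.innerCut_nonempty (Z := Zᶜ) (by rwa [compl_compl]) (by rwa [compl_compl]) hv hvZ hvV hu
    (by simpa using huZ)

theorem sub_le_ncard_innerCut (hG : G.IsFinConnected) {A : ℕ → Set α} {a b : ℕ} (hab : a ≤ b)
    (hmono : ∀ m n, m ≤ n → n ≤ b → A m ⊆ A n)
    (hne : ∀ h, a ≤ h → h < b → (G.innerCut Z (A (h + 1) \ A h)).Nonempty) :
    b - a ≤ (G.innerCut Z (A b \ A a)).ncard := by
  induction b, hab using Nat.le_induction with
  | base => simp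
  | succ b hab ih =>
    have h1 := ih (fun m n h h' => hmono m n h (by omega)) (fun h h' h'' => hne h h' (by omega))
    have h2 := (Set.ncard_pos (hG.finite_innerCut _ _)).2 (hne b hab (by omega))
    have h3 := hG.ncard_innerCut_add_le (Z := Z) (hmono a b hab (by omega))
      (hmono b (b + 1) (by omega) le_rfl)
    omega

set_option maxHeartbeats 1000000 in
/-- A chain of rigid cuts with disjoint cut-sets, all of whose members have the same trace on `S`
while consecutive members are separated by `T`, cannot be long. -/
theorem IsReplacing.chain_false (hrep : G.IsReplacing S T t q c Φ) (hG : G.IsFinConnected)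
    {r : ℕ} (htr : t ≤ r) (hqr : q ≤ r) {A : ℕ → Set α} {i j k : ℕ} (hij : i + 2 * c + 1 ≤ j)
    (hjk : j ≤ k) (hAV : ∀ h ≤ k, A h ⊆ V(G)) (hmono : ∀ a b, a ≤ b → b ≤ k → A a ⊆ A b)
    (hdis : ∀ a b, a < b → b ≤ k → Disjoint (G.cutSet (A a)) (G.cutSet (A b)))
    (hcoh : ∀ h ≤ k, G.IsCoherent Φ (A h)) (hS : Disjoint (A k \ A 0) S)
    (hT : ∀ h, i ≤ h → h < j → ((A (h + 1) \ A h) ∩ T).Nonempty)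
    (hin : A 0 = ∅ ∨ c + 1 ≤ i ∧ ∀ h < i, ((A (h + 1) \ A h) ∩ T).Nonempty)
    (hout : A k = V(G) ∨ c + 1 ≤ k - j ∧ ∀ h, j ≤ h → h < k → ((A (h + 1) \ A h) ∩ T).Nonempty)
    (hi : G.IsRigid (S ∪ T) r Φ (A i)) (hj : G.IsRigid (S ∪ T) r Φ (A j))
    (hine : (G.cutSet (A i)).Nonempty) (hjne : (G.cutSet (A j)).Nonempty)
    (hic : (G.cutSet (A i)).ncard ≤ c) (hjc : (G.cutSet (A j)).ncard ≤ c)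
    (ht : (A j \ A i).ncard ≤ t) : False := by
  have hS' : ∀ a b, a ≤ b → b ≤ k → ∀ x ∈ S, x ∈ A b → x ∈ A a := by
    intro a b _ hb x hx hxb
    by_contra hxa
    exact Set.disjoint_left.1 hS ⟨hmono b k hb le_rfl hxb,
      fun h0 => hxa (hmono 0 a (by omega) (by omega) h0)⟩ hx
  have hMcut : G.cutSet (A j \ A i) ⊆ G.cutSet (A j) ∪ G.cutSet (A i) := cutSet_sdiff_subset _ _ _
  have hMcard : (G.cutSet (A j \ A i)).ncard
      ≤ (G.cutSet (A j)).ncard + (G.cutSet (A i)).ncard :=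
    (Set.ncard_le_ncard hMcut ((hG.finite_cutSet _).union (hG.finite_cutSet _))).trans
      (Set.ncard_union_le _ _)
  -- The window avoids `S` and has at most `2c` cut edges, so `Z` takes over its terminals. The
  -- contradiction will be that `∂(Z)`, counted ring by ring, has more than `|∂(A i)| + |∂(A j)|`
  -- edges.
  obtain ⟨Z, hZV, hZT, hZq, hZΦ, hZc⟩ := hrep (A j \ A i) (Set.sdiff_subset.trans (hAV j hjk))
    (Set.disjoint_left.2 fun x hx hxS => hx.2 (hS' i j (by omega) hjk x hxS hx.1)) ht (by omega)
    (by
      obtain ⟨x, hx, hxT⟩ := hT i le_rfl (by omega)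
      exact ⟨x, ⟨hmono (i + 1) j (by omega) hjk hx.1, hx.2⟩, hxT⟩)
  have hZT' : ∀ x ∈ T, x ∈ Z ↔ x ∈ A j ∧ x ∉ A i := fun x hx => by
    simpa [hx] using Set.ext_iff.1 hZT x
  have hio : ∀ h ≤ k, G.CutInside (A h) Z ∨ G.CutInside (A h) Zᶜ := fun h hh => hcoh h hh Z hZΦ
  set f : ℕ → ℕ → ℕ := fun a b => (G.innerCut Z (A b \ A a)).ncard with hf
  have hfadd : ∀ a b d, a ≤ b → b ≤ d → d ≤ k → f a b + f b d ≤ f a d := fun a b d h1 h2 h3 =>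
    hG.ncard_innerCut_add_le (hmono a b h1 (by omega)) (hmono b d h2 h3)
  have hftot : f 0 k ≤ (G.cutSet Z).ncard :=
    Set.ncard_le_ncard Set.inter_subset_left (hG.finite_cutSet _)
  have hZfin : Z.Finite := hG.finite_of_subset hZV
  have hMfin : (A j \ A i).Finite := hG.finite_of_subset (Set.sdiff_subset.trans (hAV j hjk))
  -- replacing `A a'` by a set between `A a` and `A b`
  have key : ∀ a b a' B, a ≤ b → b ≤ k → a' = a ∨ a' = b → G.IsRigid (S ∪ T) r Φ (A a') →
      (G.cutSet (A a')).Nonempty → A a ⊆ B → B ⊆ A b → (∀ x ∈ T, x ∈ B ↔ x ∈ A a') →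
      (B \ A a' ⊆ Z ∨ B \ A a' ⊆ A j \ A i) → (A a' \ B ⊆ Z ∨ A a' \ B ⊆ A j \ A i) →
      G.cutSet B ⊆ G.innerCut Z (A b \ A a) → (G.cutSet (A a')).ncard < f a b := by
    intro a b a' B hab hb ha' hrig hne haB hBb hBT h1 h2 hcut
    have hsz : ∀ Q : Set α, (Q ⊆ Z ∨ Q ⊆ A j \ A i) → Q.ncard ≤ r := by
      rintro Q (hQ | hQ)
      · exact (Set.ncard_le_ncard hQ hZfin).trans (hZq.trans hqr)
      · exact (Set.ncard_le_ncard hQ hMfin).trans (ht.trans htr)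
    refine (hrig.ncard_lt hG hne (hBb.trans (hAV b hb)) ?_ (hsz _ h1) (hsz _ h2)
      (hcut.trans (Set.inter_subset_left.trans hZΦ))).trans_le
      (Set.ncard_le_ncard hcut (hG.finite_innerCut _ _))
    ext x
    have e1 := hS' a b hab hb x
    have e2 := hBT x
    have e3 := @haB x
    have e4 := @hBb x
    simp only [Set.mem_inter_iff, Set.mem_union]
    rcases ha' with rfl | rfl <;> clear * - e1 e2 e3 e4 <;> tauto
  have hVi : ∃ u ∈ V(G), (G.CutInside (A i) Z → u ∈ Z) ∧ (G.CutInside (A i) Zᶜ → u ∉ Z) := by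
    obtain ⟨e, x, y, hl, hx, hy⟩ := hine
    exact ⟨x, hl.left_mem, fun h => (h hl hx hy).1, fun h => (h hl hx hy).1⟩
  have hVj : ∃ u ∈ V(G), (G.CutInside (A j) Z → u ∈ Z) := by
    obtain ⟨e, x, y, hl, hx, hy⟩ := hjne
    exact ⟨x, hl.left_mem, fun h => (h hl hx hy).1⟩
  -- No terminal of `A i` lies in `Z`. Either an earlier cut lies outside `Z` and splicing gives a
  -- competitor for `A i`, or each of the `i ≥ c + 1` rings contributes an edge. If `A 0 = ∅`, its
  -- empty cut lies outside `Z` vacuously.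
  have hinner : G.CutInside (A i) Z → (G.cutSet (A i)).ncard < f 0 i := by
    intro hiZ
    by_cases hall : ∃ a < i, G.CutInside (A a) Zᶜ
    · obtain ⟨a, hai, haZ⟩ := hall
      refine (key a i i (A a ∪ (A i \ A a) \ Z) hai.le (by omega) (Or.inr rfl) hi hine
        Set.subset_union_left
        (Set.union_subset (hmono a i hai.le (by omega)) (Set.sdiff_subset.trans Set.sdiff_subset))
        (fun x hx => ?_) (Or.inl fun x hx => ?_) (Or.inl fun x hx => ?_)
        (cutSet_union_sdiff_subset (hmono a i hai.le (by omega)) (hdis a i hai (by omega))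
          haZ hiZ)).trans_le ?_
      · have m0 := hZT' x hx
        have m1 := @hmono a i hai.le (by omega) x
        simp only [Set.mem_union, Set.mem_sdiff]
        clear * - m0 m1; tauto
      · have m0 := @hmono a i hai.le (by omega) x
        simp only [Set.mem_union, Set.mem_sdiff] at hx
        clear * - m0 hx; tauto
      · simp only [Set.mem_union, Set.mem_sdiff] at hx
        clear * - hx; tauto
      · have := hfadd 0 a i (by omega) hai.le (by omega)
        omega
    · push Not at hall
      rcases hin with h0 | ⟨hci, hsl⟩
      · rcases Nat.eq_zero_or_pos i with rfl | hpos
        · rw [h0, cutSet_empty] at hine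
          exact absurd rfl hine.ne_empty
        · exact absurd (by rw [h0]; intro e x y _ hx; exact hx.elim) (hall 0 hpos)
      · have hall' : ∀ a ≤ i, G.CutInside (A a) Z := fun a ha => by
          rcases ha.eq_or_lt with rfl | ha
          · exact hiZ
          · exact (hio a (by omega)).resolve_right (hall a ha)
        have := sub_le_ncard_innerCut (Z := Z) hG (a := 0) (b := i) (by omega)
          (fun m n h h' => hmono m n h (by omega)) (fun h _ hh => by
            obtain ⟨v, hv, hvT⟩ := hsl h hh
            obtain ⟨u, hu, huZ, -⟩ := hVi
            refine hG.innerCut_nonempty' (hall' h hh.le) (hall' (h + 1) hh) hv (fun hvZ => ?_)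
              (hAV (h + 1) (by omega) hv.1) hu (huZ hiZ)
            exact ((hZT' v hvT).1 hvZ).2 (hmono (h + 1) i hh (by omega) hv.1))
        simp only [hf]
        omega
  have houter : G.CutInside (A j) Z → (G.cutSet (A j)).ncard < f j k := by
    intro hjZ
    by_cases hall : ∃ b, j < b ∧ b ≤ k ∧ G.CutInside (A b) Zᶜ
    · obtain ⟨b, hjb, hbk, hbZ⟩ := hall
      refine (key j b j (A j ∪ (A b \ A j) ∩ Z) hjb.le hbk (Or.inl rfl) hj hjne
        Set.subset_union_left
        (Set.union_subset (hmono j b hjb.le hbk) (Set.inter_subset_left.trans Set.sdiff_subset))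
        (fun x hx => ?_) (Or.inl fun x hx => ?_) (Or.inl fun x hx => ?_)
        (cutSet_union_inter_subset (hmono j b hjb.le hbk) (hdis j b hjb hbk) hjZ hbZ)).trans_le ?_
      · have m0 := hZT' x hx
        simp only [Set.mem_union, Set.mem_inter_iff, Set.mem_sdiff]
        clear * - m0; tauto
      · simp only [Set.mem_union, Set.mem_inter_iff, Set.mem_sdiff] at hx
        clear * - hx; tauto
      · simp only [Set.mem_union, Set.mem_inter_iff, Set.mem_sdiff] at hx
        clear * - hx; tauto
      · have := hfadd j b k hjb.le hbk le_rfl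
        omega
    · push Not at hall
      rcases hout with h0 | ⟨hci, hsl⟩
      · rcases hjk.eq_or_lt with rfl | hpos
        · rw [h0, cutSet_vertexSet] at hjne
          exact absurd rfl hjne.ne_empty
        · exact absurd (by rw [h0]; intro e x y hl _ hy; exact absurd hl.right_mem hy)
            (hall k hpos le_rfl)
      · have hall' : ∀ a, j ≤ a → a ≤ k → G.CutInside (A a) Z := fun a ha hak => by
          rcases ha.eq_or_lt with rfl | ha
          · exact hjZ
          · exact (hio a (by omega)).resolve_right (hall a ha hak)
        have := sub_le_ncard_innerCut (Z := Z) hG hjk hmono (fun h hjh hh => by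
            obtain ⟨v, hv, hvT⟩ := hsl h hjh hh
            obtain ⟨u, hu, huZ⟩ := hVj
            refine hG.innerCut_nonempty' (hall' h hjh hh.le) (hall' (h + 1) (by omega) hh) hv
              (fun hvZ => ?_) (hAV (h + 1) (by omega) hv.1) hu (huZ hjZ)
            exact hv.2 (hmono j h hjh hh.le ((hZT' v hvT).1 hvZ).1))
        simp only [hf]
        omega
  -- a transition inside the window
  have hdown : ∀ a, i ≤ a → a < j → G.CutInside (A a) Z → G.CutInside (A j) Zᶜ →
      (G.cutSet (A j)).ncard < f a j := by
    intro a hia haj haZ hjZ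
    refine key a j j (A a ∪ (A j \ A a) ∩ Z) haj.le hjk (Or.inr rfl) hj hjne
      Set.subset_union_left
      (Set.union_subset (hmono a j haj.le hjk) (Set.inter_subset_left.trans Set.sdiff_subset))
      (fun x hx => ?_) (Or.inr fun x hx => ?_) (Or.inr fun x hx => ?_)
      (cutSet_union_inter_subset (hmono a j haj.le hjk) (hdis a j haj hjk) haZ hjZ)
    · have m0 := hZT' x hx
      have m1 := @hmono i a hia (by omega) x
      have m2 := @hmono a j haj.le hjk x
      simp only [Set.mem_union, Set.mem_inter_iff, Set.mem_sdiff]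
      clear * - m0 m1 m2; tauto
    · have m0 := @hmono a j haj.le hjk x
      simp only [Set.mem_union, Set.mem_inter_iff, Set.mem_sdiff] at hx ⊢
      clear * - m0 hx; tauto
    · have m0 := @hmono i a hia (by omega) x
      simp only [Set.mem_union, Set.mem_inter_iff, Set.mem_sdiff] at hx ⊢
      clear * - m0 hx; tauto
  have hup : ∀ b, i < b → b ≤ j → G.CutInside (A i) Zᶜ → G.CutInside (A b) Z →
      (G.cutSet (A i)).ncard < f i b := by
    intro b hib hbj hiZ hbZ
    refine key i b i (A i ∪ (A b \ A i) \ Z) hib.le (by omega) (Or.inl rfl) hi hine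
      Set.subset_union_left
      (Set.union_subset (hmono i b hib.le (by omega)) (Set.sdiff_subset.trans Set.sdiff_subset))
      (fun x hx => ?_) (Or.inr fun x hx => ?_) (Or.inr fun x hx => ?_)
      (cutSet_union_sdiff_subset (hmono i b hib.le (by omega)) (hdis i b hib (by omega)) hiZ hbZ)
    · have m0 := hZT' x hx
      have m1 := @hmono b j hbj hjk x
      simp only [Set.mem_union, Set.mem_sdiff]
      clear * - m0 m1; tauto
    · have m0 := @hmono b j hbj hjk x
      simp only [Set.mem_union, Set.mem_sdiff] at hx ⊢
      clear * - m0 hx; tauto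
    · simp only [Set.mem_union, Set.mem_sdiff] at hx ⊢
      clear * - hx; tauto
  have hsum1 := hfadd 0 i k (by omega) (by omega) le_rfl
  have hsum2 := hfadd i j k (by omega) (by omega) le_rfl
  rcases hio i (by omega) with hiZ | hiZ <;> rcases hio j hjk with hjZ | hjZ
  · have := hinner hiZ
    have := houter hjZ
    omega
  · have := hinner hiZ
    have := hdown i le_rfl (by omega) hiZ hjZ
    omega
  · have := houter hjZ
    have := hup j (by omega) le_rfl hiZ hjZ
    omega
  -- Both end cuts lie outside `Z`. A middle cut inside `Z` gives two transitions, one charged to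
  -- each end. Otherwise each of the at least `2c + 1` rings has a terminal in `Z`, hence an edge of
  -- `∂(Z)`, but `|∂(Z)| ≤ 2c`.
  · by_cases hmid : ∃ h, i < h ∧ h < j ∧ G.CutInside (A h) Z
    · obtain ⟨h, h1, h2, hZ⟩ := hmid
      have := hup h h1 h2.le hiZ hZ
      have := hdown h h1.le h2 hZ hjZ
      have := hfadd i h j h1.le h2.le hjk
      omega
    · push Not at hmid
      have hall' : ∀ a, i ≤ a → a ≤ j → G.CutInside (A a) Zᶜ := fun a ha haj => by
        rcases ha.eq_or_lt with rfl | ha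
        · exact hiZ
        · rcases haj.eq_or_lt with rfl | haj
          · exact hjZ
          · exact (hio a (by omega)).resolve_left (hmid a ha haj)
      have := sub_le_ncard_innerCut (Z := Z) hG (a := i) (b := j) (by omega)
        (fun m n h h' => hmono m n h (by omega)) (fun h hih hh => by
          obtain ⟨v, hv, hvT⟩ := hT h hih hh
          obtain ⟨u, hu, -, huZ⟩ := hVi
          exact hG.innerCut_nonempty (hall' h hih hh.le) (hall' (h + 1) (by omega) hh) hv
            ((hZT' v hvT).2 ⟨hmono (h + 1) j hh hjk hv.1,
              fun h' => hv.2 (hmono i h hih (by omega) h')⟩)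
            (hAV (h + 1) (by omega) hv.1) hu (huZ hiZ))
      simp only [hf] at *
      omega

/-! ### Greedy sequences of cuts -/

/-- A small cut with at most `c` and at least one edge, and with a nonempty trace on `K`. -/
structure IsCandidate (G : Graph α β) (K : Set α) (t c : ℕ) (X : Set α) : Prop where
  subset : X ⊆ V(G)
  ncard_le : X.ncard ≤ t
  trace_nonempty : (X ∩ K).Nonempty
  cutSet_nonempty : (G.cutSet X).Nonempty
  ncard_cutSet_le : (G.cutSet X).ncard ≤ c

/-- Some cut with the same trace on `K` as `X` and no more edges is smaller than `∂(X)`, meets `Φ`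
or is separated by a cut contained in `Φ`. -/
def IsImprovable (G : Graph α β) (K : Set α) (r : ℕ) (Φ : Set β) (X : Set α) : Prop :=
  ∃ B ⊆ V(G), B ∩ K = X ∩ K ∧ B.ncard ≤ r + X.ncard ∧
    (G.cutSet B).ncard ≤ (G.cutSet X).ncard ∧
    ((G.cutSet B).ncard < (G.cutSet X).ncard ∨ ¬Disjoint (G.cutSet B) Φ ∨ ¬G.IsCoherent Φ B)

theorem IsImprovable.mono {r : ℕ} (h : G.IsImprovable K r Φ X) (hΦ : Φ ⊆ Ψ) :
    G.IsImprovable K r Ψ X := by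
  obtain ⟨B, h1, h2, h3, h4, h5⟩ := h
  exact ⟨B, h1, h2, h3, h4, h5.imp_right (Or.imp (mt (·.mono_right hΦ)) (mt (·.mono hΦ)))⟩

/-- The set `Φ` together with the cut-sets of the first `m` members of `W`. -/
def addCuts (G : Graph α β) (Φ : Set β) (W : ℕ → Set α) (m : ℕ) : Set β :=
  {e | e ∈ Φ ∨ ∃ l < m, e ∈ G.cutSet (W l)}

theorem addCuts_mono {W : ℕ → Set α} {l m : ℕ} (h : l ≤ m) :
    G.addCuts Φ W l ⊆ G.addCuts Φ W m := by
  rintro e (he | ⟨k, hk, he⟩)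
  · exact Or.inl he
  · exact Or.inr ⟨k, hk.trans_le h, he⟩

theorem subset_addCuts {W : ℕ → Set α} {m : ℕ} : Φ ⊆ G.addCuts Φ W m := fun _ h => Or.inl h

theorem cutSet_subset_addCuts {W : ℕ → Set α} {l m : ℕ} (h : l < m) :
    G.cutSet (W l) ⊆ G.addCuts Φ W m := fun _ he => Or.inr ⟨l, h, he⟩

theorem addCuts_congr {W W' : ℕ → Set α} {m : ℕ} (h : ∀ l < m, W l = W' l) :
    G.addCuts Φ W m = G.addCuts Φ W' m := by
  ext e
  refine or_congr_right ⟨?_, ?_⟩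
  · rintro ⟨l, hl, he⟩
    exact ⟨l, hl, h l hl ▸ he⟩
  · rintro ⟨l, hl, he⟩
    exact ⟨l, hl, h l hl ▸ he⟩

/-- Each of the first `N` members of `W` is a candidate that could not be improved before, and has
the smallest possible cut-set. -/
def IsGreedy (G : Graph α β) (K : Set α) (t c r : ℕ) (Φ : Set β) (W : ℕ → Set α) (N : ℕ) : Prop :=
  ∀ m < N, G.IsCandidate K t c (W m) ∧ ¬G.IsImprovable K r (G.addCuts Φ W m) (W m) ∧
    ∀ X, G.IsCandidate K t c X → (G.cutSet X).ncard < (G.cutSet (W m)).ncard →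
      G.IsImprovable K r (G.addCuts Φ W m) X

/-- Greedy sequences can be continued until all candidates can be improved. -/
theorem exists_isGreedy (G : Graph α β) (K : Set α) (t c r : ℕ) (Φ : Set β) (N : ℕ) :
    ∃ W M, M ≤ N ∧ G.IsGreedy K t c r Φ W M ∧
      (M = N ∨ ∀ X, G.IsCandidate K t c X → G.IsImprovable K r (G.addCuts Φ W M) X) := by
  induction N with
  | zero => exact ⟨fun _ => ∅, 0, le_rfl, fun m hm => absurd hm (Nat.not_lt_zero m), Or.inl rfl⟩
  | succ N ih =>
    obtain ⟨W, M, hMN, hW, hM⟩ := ih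
    by_cases hall : ∀ X, G.IsCandidate K t c X → G.IsImprovable K r (G.addCuts Φ W M) X
    · exact ⟨W, M, by omega, hW, Or.inr hall⟩
    obtain rfl := hM.resolve_right hall
    push Not at hall
    -- The cheapest non-improvable candidate is taken; this later makes the cut sizes monotone and
    -- the sets connected.
    have hex : ∃ a, ∃ X, G.IsCandidate K t c X ∧ ¬G.IsImprovable K r (G.addCuts Φ W M) X ∧
        (G.cutSet X).ncard = a := by
      obtain ⟨X, h1, h2⟩ := hall
      exact ⟨_, X, h1, h2, rfl⟩
    classical
    obtain ⟨X, h1, h2, h3⟩ := Nat.find_spec hex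
    have hmin := fun m => Nat.find_min hex (m := m)
    rw [← h3] at hmin
    have hcongr : ∀ m ≤ M, G.addCuts Φ (Function.update W M X) m = G.addCuts Φ W m := fun m hm =>
      addCuts_congr fun l hl => Function.update_of_ne (by omega) _ _
    refine ⟨Function.update W M X, M + 1, le_rfl, fun m hm => ?_, Or.inl rfl⟩
    rw [hcongr m (by omega)]
    rcases (Nat.lt_succ_iff.1 hm).eq_or_lt with rfl | hlt
    · rw [Function.update_self]
      refine ⟨h1, h2, fun Y hY hlt => ?_⟩
      by_contra hYi
      exact hmin _ hlt ⟨Y, hY, hYi, rfl⟩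
    · rw [Function.update_of_ne (by omega)]
      exact hW m hlt

/-- The properties of greedy sequences that bound their length. -/
structure IsCutSeq (G : Graph α β) (K : Set α) (t c r : ℕ) (Φ : Set β) (W : ℕ → Set α)
    (N : ℕ) : Prop where
  candidate : ∀ m < N, G.IsCandidate K t c (W m)
  coherent : ∀ m < N, G.IsCoherent (G.addCuts Φ W m) (W m)
  minimal : ∀ m < N, ∀ B ⊆ V(G), B ∩ K = W m ∩ K → B.ncard ≤ r + (W m).ncard →
    (G.cutSet B).ncard ≤ (G.cutSet (W m)).ncard →
      (G.cutSet B).ncard = (G.cutSet (W m)).ncard ∧ Disjoint (G.cutSet B) (G.addCuts Φ W m)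
  mono : ∀ l m, l < m → m < N → (G.cutSet (W l)).ncard ≤ (G.cutSet (W m)).ncard
  unsplit : ∀ m < N, G.IsUnsplit (W m)

/-- Sizes are monotone because a cheaper later set was improvable earlier, and improvability
persists as `Φ` grows. If `W m` split into parts with no edge between them, their cuts would add up.
A part with terminals would then be a cheaper candidate, hence improvable, and would pass its
improvement on to `W m`; a part without terminals could be dropped. -/
theorem IsGreedy.isCutSeq (hG : G.IsFinConnected) {r : ℕ} (h : G.IsGreedy K t c r Φ W N) :
    G.IsCutSeq K t c r Φ W N := by
  have hmin : ∀ m < N, ∀ B ⊆ V(G), B ∩ K = W m ∩ K → B.ncard ≤ r + (W m).ncard →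
    (G.cutSet B).ncard ≤ (G.cutSet (W m)).ncard →
      (G.cutSet B).ncard = (G.cutSet (W m)).ncard ∧
        Disjoint (G.cutSet B) (G.addCuts Φ W m) := by
    intro m hm B hB hK hc hle
    have := (h m hm).2.1
    constructor
    · by_contra hne
      exact this ⟨B, hB, hK, hc, hle, Or.inl (lt_of_le_of_ne hle hne)⟩
    · by_contra hne
      exact this ⟨B, hB, hK, hc, hle, Or.inr (Or.inl hne)⟩
  refine ⟨fun m hm => (h m hm).1, fun m hm => ?_, hmin, fun l m hlm hm => ?_, fun m hm => ?_⟩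
  · by_contra hne
    exact (h m hm).2.1 ⟨W m, (h m hm).1.subset, rfl, by omega, le_rfl, Or.inr (Or.inr hne)⟩
  · by_contra hlt
    exact (h m hm).2.1
      (((h l (hlm.trans hm)).2.2 _ (h m hm).1 (not_le.1 hlt)).mono (addCuts_mono hlm.le))
  · intro Y a b ha haY hb hbY
    by_contra hno
    obtain ⟨hcand, -, hsm⟩ := h m hm
    have hno' : ∀ ⦃e x y⦄, G.IsLink e x y → x ∈ W m → y ∈ W m → x ∈ Y → y ∈ Y := by
      intro e x y hl hx hy hxY
      by_contra hyY
      exact hno ⟨e, x, y, hl, hx, hy, hxY, hyY⟩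
    have hWV := hcand.subset
    -- a part with nonempty trace is improvable, hence so is the whole
    have main : ∀ K₁ K₂ : Set α, K₁ ∪ K₂ = W m → Disjoint K₁ K₂ → K₁.Nonempty → K₂.Nonempty →
        (∀ ⦃e x y⦄, G.IsLink e x y → x ∈ K₁ → y ∉ K₂) → K₁ ∩ K = ∅ := by
      intro K₁ K₂ hU hd hne₁ hne₂ hlink
      by_contra hK₁
      have hmem : ∀ x, x ∈ W m ↔ x ∈ K₁ ∨ x ∈ K₂ := fun x => by rw [← hU]; rfl
      have hdd := Set.disjoint_left.1 hd
      have hfin₁ : K₁.Finite := (hG.finite_of_subset hWV).subset (hU ▸ Set.subset_union_left)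
      have hfin₂ : K₂.Finite := (hG.finite_of_subset hWV).subset (hU ▸ Set.subset_union_right)
      have hcutU : G.cutSet (W m) = G.cutSet K₁ ∪ G.cutSet K₂ := by
        refine Set.Subset.antisymm (hU ▸ cutSet_union_subset _ _ _) ?_
        rintro e (⟨x, y, hl, hx, hy⟩ | ⟨x, y, hl, hx, hy⟩)
        · exact ⟨x, y, hl, (hmem x).2 (Or.inl hx), fun h' => ((hmem y).1 h').elim hy (hlink hl hx)⟩
        · exact ⟨x, y, hl, (hmem x).2 (Or.inr hx),
            fun h' => ((hmem y).1 h').elim (fun h'' => hlink hl.symm h'' hx) hy⟩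
      have hcutd : Disjoint (G.cutSet K₁) (G.cutSet K₂) := by
        rw [Set.disjoint_left]
        rintro e ⟨x, y, hl, hx, hy⟩ h2
        have := @hdd x hx
        have := hlink hl hx
        rw [hl.mem_cutSet_iff] at h2
        tauto
      have hcard : (G.cutSet (W m)).ncard = (G.cutSet K₁).ncard + (G.cutSet K₂).ncard := by
        rw [hcutU, Set.ncard_union_eq hcutd (hG.finite_cutSet _) (hG.finite_cutSet _)]
      have hK₂pos : 0 < (G.cutSet K₂).ncard := by
        obtain ⟨x, hx⟩ := hne₂
        obtain ⟨y, hy⟩ := hne₁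
        exact (Set.ncard_pos (hG.finite_cutSet _)).2 (hG.cutSet_nonempty
          (hWV ((hmem x).2 (Or.inr hx))) (hWV ((hmem y).2 (Or.inl hy))) hx (hdd hy))
      have hK₁pos : (G.cutSet K₁).Nonempty := by
        obtain ⟨x, hx⟩ := hne₂
        obtain ⟨y, hy⟩ := hne₁
        exact hG.cutSet_nonempty
          (hWV ((hmem y).2 (Or.inl hy))) (hWV ((hmem x).2 (Or.inr hx))) hy (fun h' => hdd h' hx)
      obtain ⟨B, hBV, hBK, hBc, hBle, hBor⟩ := hsm K₁
        ⟨fun x hx => hWV ((hmem x).2 (Or.inl hx)),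
          (Set.ncard_le_ncard (hU ▸ Set.subset_union_left) (hG.finite_of_subset hWV)).trans
            hcand.ncard_le, Set.nonempty_iff_ne_empty.2 hK₁, hK₁pos,
          by have := hcand.ncard_cutSet_le; omega⟩ (by omega)
      have hWc : (W m).ncard = K₁.ncard + K₂.ncard := by
        rw [← hU, Set.ncard_union_eq hd hfin₁ hfin₂]
      have hsub := cutSet_union_subset G B K₂
      have hfin := (hG.finite_cutSet B).union (hG.finite_cutSet K₂)
      have hle1 := Set.ncard_le_ncard hsub hfin
      have hle2 := Set.ncard_union_le (G.cutSet B) (G.cutSet K₂)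
      -- Exchanging `K₁` for `B` costs at most `|∂(B)| + |∂(K₂)| ≤ |∂(W m)|`. Minimality forces
      -- equality, so `∂(B)` is contained in the new cut and any defect of `B` is one of `B ∪ K₂`.
      obtain ⟨heq, hdis⟩ := hmin m hm (B ∪ K₂)
        (Set.union_subset hBV fun x hx => hWV ((hmem x).2 (Or.inr hx)))
        (by rw [Set.union_inter_distrib_right, hBK, ← hU, Set.union_inter_distrib_right])
        ((Set.ncard_union_le _ _).trans (by omega)) (by omega)
      have hEq := Set.eq_of_subset_of_ncard_le hsub (by omega) hfin
      rcases hBor with hlt | hnd | hnc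
      · omega
      · exact hnd ((hEq ▸ hdis).mono_left Set.subset_union_left)
      · refine (h m hm).2.1 ⟨B ∪ K₂,
          (Set.union_subset hBV fun x hx => hWV ((hmem x).2 (Or.inr hx))),
          (by rw [Set.union_inter_distrib_right, hBK, ← hU, Set.union_inter_distrib_right]),
          ((Set.ncard_union_le _ _).trans (by omega)), (by omega), Or.inr (Or.inr fun hco => ?_)⟩
        exact hnc (hco.of_cutSet_subset (hEq ▸ Set.subset_union_left))
    -- a part with empty trace may be dropped
    have drop : ∀ K₁ K₂ : Set α, K₁ ∪ K₂ = W m → Disjoint K₁ K₂ → K₁.Nonempty → K₂.Nonempty →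
        (∀ ⦃e x y⦄, G.IsLink e x y → x ∈ K₁ → y ∉ K₂) → K₁ ∩ K = ∅ → False := by
      intro K₁ K₂ hU hd hne₁ hne₂ hlink hK₁
      have hmem : ∀ x, x ∈ W m ↔ x ∈ K₁ ∨ x ∈ K₂ := fun x => by rw [← hU]; rfl
      have hdd := Set.disjoint_left.1 hd
      have hK₁pos : (G.cutSet K₁).Nonempty := by
        obtain ⟨x, hx⟩ := hne₂
        obtain ⟨y, hy⟩ := hne₁
        exact hG.cutSet_nonempty
          (hWV ((hmem y).2 (Or.inl hy))) (hWV ((hmem x).2 (Or.inr hx))) hy (fun h' => hdd h' hx)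
      have hss : G.cutSet K₂ ⊂ G.cutSet (W m) := by
        refine Set.ssubset_iff_exists.2 ⟨?_, ?_⟩
        · rintro e ⟨x, y, hl, hx, hy⟩
          exact ⟨x, y, hl, (hmem x).2 (Or.inr hx),
            fun h' => ((hmem y).1 h').elim (fun h'' => hlink hl.symm h'' hx) hy⟩
        · obtain ⟨e, x, y, hl, hx, hy⟩ := hK₁pos
          refine ⟨e, ⟨x, y, hl, (hmem x).2 (Or.inl hx),
            fun h' => ((hmem y).1 h').elim hy (hlink hl hx)⟩, fun h2 => ?_⟩
          have := @hdd x hx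
          have := hlink hl hx
          rw [hl.mem_cutSet_iff] at h2
          tauto
      have hlt := Set.ncard_lt_ncard hss (hG.finite_cutSet _)
      have := (hmin m hm K₂ (fun x hx => hWV ((hmem x).2 (Or.inr hx)))
        (by rw [← hU, Set.union_inter_distrib_right, hK₁, Set.empty_union])
        ((Set.ncard_le_ncard (hU ▸ Set.subset_union_right) (hG.finite_of_subset hWV)).trans
          (by omega)) hlt.le).1
      omega
    have hU1 : W m ∩ Y ∪ W m \ Y = W m := Set.inter_union_sdiff _ _
    have hd1 : Disjoint (W m ∩ Y) (W m \ Y) := Set.disjoint_left.2 fun x hx hx' => hx'.2 hx.2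
    have hl1 : ∀ ⦃e x y⦄, G.IsLink e x y → x ∈ W m ∩ Y → y ∉ W m \ Y :=
      fun e x y hl hx hy => hy.2 (hno' hl hx.1 hy.1 hx.2)
    exact drop _ _ hU1 hd1 ⟨a, ha, haY⟩ ⟨b, hb, hbY⟩ hl1
      (main _ _ hU1 hd1 ⟨a, ha, haY⟩ ⟨b, hb, hbY⟩ hl1)

namespace IsCutSeq

variable {r l m : ℕ}

theorem nonempty_cutSet (h : G.IsCutSeq K t c r Φ W N) (hm : m < N) : (G.cutSet (W m)).Nonempty :=
  (h.candidate m hm).cutSet_nonempty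

theorem subset (h : G.IsCutSeq K t c r Φ W N) (hm : m < N) : W m ⊆ V(G) :=
  (h.candidate m hm).subset

theorem disjoint_of_lt (h : G.IsCutSeq K t c r Φ W N) (hlm : l < m) (hm : m < N) :
    Disjoint (G.cutSet (W l)) (G.cutSet (W m)) :=
  ((h.minimal m hm (W m) (h.subset hm) rfl (by omega) le_rfl).2.mono_right
    (cutSet_subset_addCuts hlm)).symm

theorem disjoint_of_ne (h : G.IsCutSeq K t c r Φ W N) (hlm : l ≠ m) (hl : l < N) (hm : m < N) :
    Disjoint (G.cutSet (W l)) (G.cutSet (W m)) := by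
  rcases hlm.lt_or_gt with hlt | hlt
  · exact h.disjoint_of_lt hlt hm
  · exact (h.disjoint_of_lt hlt hl).symm

theorem isRigid (h : G.IsCutSeq K t c r Φ W N) (hG : G.IsFinConnected) (hm : m < N) :
    G.IsRigid K r (G.addCuts Φ W m) (W m) := by
  intro B hB hK h1 _ hle
  refine h.minimal m hm B hB hK ?_ hle
  have hWfin := hG.finite_of_subset (h.subset hm)
  have := Set.ncard_le_ncard_sdiff_add_ncard B (W m) hWfin
  omega

/-- With equal traces the earlier set would compete with the later one, although its cut already
belongs to the enlarged `Φ`. -/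
theorem trace_ne (h : G.IsCutSeq K t c r Φ W N) (htr : t ≤ r) (hlm : l < m) (hm : m < N) :
    W l ∩ K ≠ W m ∩ K := by
  intro heq
  have hl := hlm.trans hm
  have := (h.minimal m hm (W l) (h.subset hl) heq
    ((h.candidate l hl).ncard_le.trans (by omega)) (h.mono l m hlm hm)).2
  exact (h.nonempty_cutSet hl).ne_empty
    (Set.subset_empty_iff.1 (this subset_rfl (cutSet_subset_addCuts hlm)))

end IsCutSeq

/-! ### Laminarity of cuts with the same trace on `S` -/

namespace IsCutSeq

/-- Coherence puts `∂(W m)` on one side of `W l`. If outside, connectedness of `W l` decides. If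
inside, `W m \ W l` and the rest outside both sets are attached only to `W l` and split its cut
edges between them; a substitute for `W m \ W l` then produces a competitor that is too cheap. -/
theorem nested_or_disjoint_or_cover (h : G.IsCutSeq (S ∪ T) t c q' Φ W N) (hG : G.IsFinConnected)
    (hrep : G.IsReplacing S T t q c Φ) (htq : t ≤ q) (hqq' : q ≤ q') (hlm : l < m) (hm : m < N)
    (hS : W l ∩ S = W m ∩ S) :
    W l ⊆ W m ∨ W m ⊆ W l ∨ Disjoint (W l) (W m) ∨ V(G) ⊆ W l ∪ W m := by
  have hl := hlm.trans hm
  have hlV := h.subset hl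
  have hmV := h.subset hm
  have hS' : ∀ x ∈ S, x ∈ W l ↔ x ∈ W m := fun x hx => by simpa [hx] using Set.ext_iff.1 hS x
  rcases h.coherent m hm (W l) (cutSet_subset_addCuts hlm) with hB | hB
  swap
  · by_cases hd : Disjoint (W l) (W m)
    · exact Or.inr (Or.inr (Or.inl hd))
    left
    obtain ⟨a, hal, ham⟩ := Set.not_disjoint_iff.1 hd
    intro b hb
    by_contra hbm
    obtain ⟨e, x, y, hlk, hx, -, hxm, hym⟩ := h.unsplit l hl hal ham hb hbm
    exact (hB hlk hxm hym).1 hx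
  by_cases hDin : W m \ W l = ∅
  · exact Or.inr (Or.inl (Set.sdiff_eq_empty.1 hDin))
  by_cases hDout : V(G) \ (W l ∪ W m) = ∅
  · exact Or.inr (Or.inr (Or.inr (Set.sdiff_eq_empty.1 hDout)))
  exfalso
  obtain ⟨u, hum, hul⟩ := Set.nonempty_iff_ne_empty.2 hDin
  obtain ⟨v, hvV, hv⟩ := Set.nonempty_iff_ne_empty.2 hDout
  have hin : ∀ ⦃e x y⦄, G.IsLink e x y → x ∈ W m \ W l → y ∉ W m \ W l → y ∈ W l := by
    intro e x y hlk hx hy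
    by_contra hyl
    exact hyl (hB hlk hx.1 fun hym => hy ⟨hym, hyl⟩).2
  have hout : ∀ ⦃e x y⦄, G.IsLink e x y → x ∉ W l → x ∉ W m → y ∈ W l ∪ W m → y ∈ W l := by
    intro e x y hlk hxl hxm hy
    by_contra hyl
    exact hxl (hB hlk.symm (hy.resolve_left hyl) hxm).2
  have hcoutEq : G.cutSet (V(G) \ (W l ∪ W m)) = G.cutSet (W l ∪ W m) := cutSet_sdiff_vertexSet _ _
  have hcin : (G.cutSet (W m \ W l)).Nonempty :=
    hG.cutSet_nonempty (hmV hum) hvV ⟨hum, hul⟩ fun h' => hv (Or.inr h'.1)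
  have hcout : (G.cutSet (W l ∪ W m)).Nonempty :=
    hG.cutSet_nonempty (hmV hum) hvV (Or.inr hum) hv
  have hsum : (G.cutSet (W m \ W l)).ncard + (G.cutSet (W l ∪ W m)).ncard
      ≤ (G.cutSet (W l)).ncard := by
    rw [← Set.ncard_union_eq _ (hG.finite_cutSet _) (hG.finite_cutSet _)]
    · refine Set.ncard_le_ncard (Set.union_subset ?_ ?_) (hG.finite_cutSet _)
      · rintro e ⟨x, y, hlk, hx, hy⟩
        exact ⟨y, x, hlk.symm, hin hlk hx hy, hx.2⟩
      · rintro e ⟨x, y, hlk, hx, hy⟩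
        rw [Set.mem_union, not_or] at hy
        exact ⟨x, y, hlk, hout hlk.symm hy.1 hy.2 hx, hy.1⟩
    · rw [Set.disjoint_left]
      rintro e ⟨x, y, hlk, hx, hy⟩ h2
      have h3 := hin hlk hx hy
      rw [hlk.mem_cutSet_iff] at h2
      rcases h2 with h2 | h2
      · exact h2.2 (Or.inl h3)
      · exact h2.1 (Or.inr hx.1)
  have hposin := (Set.ncard_pos (hG.finite_cutSet _)).2 hcin
  have hposout := (Set.ncard_pos (hG.finite_cutSet _)).2 hcout
  have hmono := h.mono l m hlm hm
  have hcl := (h.candidate l hl).ncard_cutSet_le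
  have htl := (h.candidate l hl).ncard_le
  have htm := (h.candidate m hm).ncard_le
  have hDint : (W m \ W l).ncard ≤ t :=
    (Set.ncard_le_ncard Set.sdiff_subset (hG.finite_of_subset hmV)).trans htm
  -- Without a terminal there, `W l ∪ W m` would have the trace of `W l` and a strictly smaller cut.
  have hDinT : ((W m \ W l) ∩ T).Nonempty := by
    rw [Set.nonempty_iff_ne_empty]
    intro hE
    have hE' : ∀ x ∈ T, x ∈ W m → x ∈ W l := fun x hx hxm => by
      by_contra hxl
      exact (hE ▸ (⟨⟨hxm, hxl⟩, hx⟩ : x ∈ (W m \ W l) ∩ T) : x ∈ (∅ : Set α))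
    have := (h.minimal l hl (W l ∪ W m) (Set.union_subset hlV hmV) (by
      ext x
      have h1 := hS' x
      have h2 := hE' x
      simp only [Set.mem_inter_iff, Set.mem_union]
      clear * - h1 h2
      tauto) ((Set.ncard_union_le _ _).trans (by omega)) (by omega)).1
    omega
  obtain ⟨Z, hZV, hZT, hZq, hZΦ, hZc⟩ := hrep (W m \ W l) (Set.sdiff_subset.trans hmV)
    (Set.disjoint_left.2 fun x hx hxS => hx.2 ((hS' x hxS).2 hx.1)) hDint (by omega) hDinT
  have hZT' : ∀ x ∈ T, x ∈ Z ↔ x ∈ W m ∧ x ∉ W l := fun x hx => by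
    simpa [hx] using Set.ext_iff.1 hZT x
  have hZfin := hG.finite_of_subset hZV
  -- a cut contained in `∂(Z) ∪ ∂(W l ∪ W m)` contradicts minimality
  have key : ∀ k < N, l ≤ k → ∀ B ⊆ V(G), B ∩ (S ∪ T) = W k ∩ (S ∪ T) →
      B.ncard ≤ q' + (W k).ncard →
      (∀ ⦃e x y⦄, G.IsLink e x y → x ∈ B → y ∉ B →
        (y ∉ W l ∧ y ∉ W m ∧ (x ∈ W l ∨ x ∈ W m)) ∨ (x ∈ Z ↔ y ∉ Z)) → False := by
    intro k hk hlk B hBV hBK hBc hBl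
    have hsub : G.cutSet B ⊆ G.cutSet Z ∪ G.cutSet (W l ∪ W m) := by
      refine cutSet_subset_of_isLink fun e x y hlk hx hy => ?_
      have := hBl hlk hx hy
      simp only [Set.mem_union, hlk.mem_cutSet_iff]
      clear * - this
      tauto
    have hle : (G.cutSet B).ncard ≤ (G.cutSet Z).ncard + (G.cutSet (W l ∪ W m)).ncard :=
      (Set.ncard_le_ncard hsub ((hG.finite_cutSet _).union (hG.finite_cutSet _))).trans
        (Set.ncard_union_le _ _)
    have hlk' : (G.cutSet (W l)).ncard ≤ (G.cutSet (W k)).ncard := by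
      rcases hlk.eq_or_lt with rfl | hlt
      · exact le_rfl
      · exact h.mono l k hlt hk
    -- The cut of `B` has at most `|∂(W l)| ≤ |∂(W k)|` edges, so it avoids `Φ` and with it `∂(Z)`.
    -- What is left lies in `∂(W l ∪ W m)`, which is strictly smaller than `∂(W l)`.
    obtain ⟨heq, hdis⟩ := h.minimal k hk B hBV hBK hBc (by omega)
    have hsub' : G.cutSet B ⊆ G.cutSet (W l ∪ W m) := fun e he =>
      (hsub he).resolve_left fun heZ => Set.disjoint_left.1 hdis he (subset_addCuts (hZΦ heZ))
    have := Set.ncard_le_ncard hsub' (hG.finite_cutSet _)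
    omega
  rcases h.coherent l hl Z (hZΦ.trans subset_addCuts) with hlZ | hlZ
  swap
  · refine key l hl le_rfl (W l ∪ W m \ Z) (Set.union_subset hlV (Set.sdiff_subset.trans hmV)) ?_
      ((Set.ncard_union_le _ _).trans (by
        have := Set.ncard_le_ncard (Set.sdiff_subset (s := W m) (t := Z)) (hG.finite_of_subset hmV)
        omega)) ?_
    · ext x
      have h1 := hS' x
      have h2 := hZT' x
      simp only [Set.mem_inter_iff, Set.mem_union, Set.mem_sdiff]
      clear * - h1 h2
      tauto
    · intro e x y hlk hx hy
      have h1 := @hlZ e x y hlk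
      simp only [Set.mem_union, Set.mem_sdiff, Set.mem_compl_iff] at hx hy h1
      clear * - hx hy h1
      tauto
  rcases h.coherent m hm Z (hZΦ.trans subset_addCuts) with hmZ | hmZ
  swap
  -- Here `∂(W l)` lies inside `Z` and `∂(W m)` outside. So `Z ∩ W m` has its cut in `Φ`, yet
  -- separates edges of `∂(W l)` towards `W m \ W l` from those leaving the union, against coherence
  -- of `W l`.
  · have hcut : G.cutSet (Z ∩ W m) ⊆ G.addCuts Φ W l := by
      rintro e ⟨x, y, hlk, hx, hy⟩
      refine subset_addCuts (hZΦ ⟨x, y, hlk, hx.1, fun hyZ => ?_⟩)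
      exact (hmZ hlk hx.2 fun hym => hy ⟨hyZ, hym⟩).1 hx.1
    rcases h.coherent l hl _ hcut with h1 | h1
    · obtain ⟨e, x, y, hlk, hx, hy⟩ := hcout
      rw [Set.mem_union, not_or] at hy
      exact hy.2 (h1 hlk (hout hlk.symm hy.1 hy.2 hx) hy.1).2.2
    · obtain ⟨e, x, y, hlk, hx, hy⟩ := hcin
      have hyl := hin hlk hx hy
      exact (h1 hlk.symm hyl hx.2).2 ⟨(hlZ hlk.symm hyl hx.2).2, hx.1⟩
  · refine key m hm hlm.le (W m ∪ W l ∩ Z) (Set.union_subset hmV (Set.inter_subset_left.trans hlV))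
      ?_ ((Set.ncard_union_le _ _).trans (by
        have := Set.ncard_le_ncard (Set.inter_subset_right (s := W l) (t := Z)) hZfin
        omega)) ?_
    · ext x
      have h1 := hS' x
      have h2 := hZT' x
      simp only [Set.mem_inter_iff, Set.mem_union]
      clear * - h1 h2
      tauto
    · intro e x y hlk hx hy
      have h1 := @hmZ e x y hlk
      simp only [Set.mem_union, Set.mem_inter_iff] at hx hy
      clear * - hx hy h1
      tauto

theorem nested_or_disjoint_or_cover' (h : G.IsCutSeq (S ∪ T) t c q' Φ W N)
    (hG : G.IsFinConnected) (hrep : G.IsReplacing S T t q c Φ) (htq : t ≤ q) (hqq' : q ≤ q')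
    (hl : l < N) (hm : m < N) (hS : W l ∩ S = W m ∩ S) :
    W l ⊆ W m ∨ W m ⊆ W l ∨ Disjoint (W l) (W m) ∨ V(G) ⊆ W l ∪ W m := by
  rcases lt_trichotomy l m with hlt | rfl | hlt
  · exact h.nested_or_disjoint_or_cover hG hrep htq hqq' hlt hm hS
  · exact Or.inl subset_rfl
  · rcases h.nested_or_disjoint_or_cover hG hrep htq hqq' hlt hl hS.symm with h' | h' | h' | h'
    · exact Or.inr (Or.inl h')
    · exact Or.inl h'
    · exact Or.inr (Or.inr (Or.inl h'.symm))
    · exact Or.inr (Or.inr (Or.inr (by rwa [Set.union_comm])))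

theorem sdiff_inter_nonempty (h : G.IsCutSeq (S ∪ T) t c q' Φ W N) (htq' : t ≤ q') (hl : l < N)
    (hm : m < N) (hlm : l ≠ m) (hsub : W l ⊆ W m) (hS : W l ∩ S = W m ∩ S) :
    ((W m \ W l) ∩ T).Nonempty := by
  rw [Set.nonempty_iff_ne_empty]
  intro hE
  have heq : W l ∩ (S ∪ T) = W m ∩ (S ∪ T) := by
    rw [Set.inter_union_distrib_left, Set.inter_union_distrib_left, hS]
    congr 1
    refine Set.Subset.antisymm (Set.inter_subset_inter_left _ hsub) fun x hx => ⟨?_, hx.2⟩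
    by_contra hxl
    exact (hE ▸ (⟨⟨hx.1, hxl⟩, hx.2⟩ : x ∈ (W m \ W l) ∩ T) : x ∈ (∅ : Set α))
  rcases hlm.lt_or_gt with hlt | hlt
  · exact h.trace_ne htq' hlt hm heq
  · exact h.trace_ne htq' hlt hl heq.symm

end IsCutSeq

/-- A finite family of sets that is totally ordered by strict inclusion can be listed in
increasing order. -/
theorem exists_enum_of_chain {f : ℕ → Set α} (I : Finset ℕ) (hfin : ∀ m ∈ I, (f m).Finite)
    (hchain : ∀ a ∈ I, ∀ b ∈ I, a ≠ b → f a ⊂ f b ∨ f b ⊂ f a) :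
    ∃ g : ℕ → ℕ, (∀ a < I.card, g a ∈ I) ∧ ∀ a b, a < b → b < I.card → f (g a) ⊂ f (g b) := by
  classical
  induction hn : I.card generalizing I with
  | zero => exact ⟨id, by simp, by simp⟩
  | succ n ih =>
    obtain ⟨m, hm, hmax⟩ := I.exists_max_image (fun m => (f m).ncard)
      (Finset.card_pos.1 (by omega))
    have hcard : (I.erase m).card = n := by rw [Finset.card_erase_of_mem hm]; omega
    obtain ⟨g, hg, hlt⟩ := ih (I.erase m) (fun a ha => hfin a (Finset.mem_of_mem_erase ha))
      (fun a ha b hb => hchain a (Finset.mem_of_mem_erase ha) b (Finset.mem_of_mem_erase hb)) hcard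
    refine ⟨Function.update g n m, fun a ha => ?_, fun a b hab hb => ?_⟩
    · rcases (Nat.lt_succ_iff.1 ha).eq_or_lt with rfl | ha
      · simpa using hm
      · rw [Function.update_of_ne ha.ne]
        exact Finset.mem_of_mem_erase (hg a ha)
    · rw [Function.update_of_ne (by omega)]
      rcases (Nat.lt_succ_iff.1 hb).eq_or_lt with rfl | hb
      · rw [Function.update_self]
        have hga := hg a hab
        have haI := Finset.mem_of_mem_erase hga
        refine (hchain _ haI m hm (Finset.ne_of_mem_erase hga)).resolve_right fun hss => ?_
        have := Set.ncard_lt_ncard hss (hfin _ haI)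
        have := hmax _ haI
        omega
      · rw [Function.update_of_ne (by omega)]
        exact hlt a b hab hb

namespace IsCutSeq

/-- Nested members of a cut sequence that all avoid `S`, or all contain `S`, are few. -/
theorem card_le_of_nested (h : G.IsCutSeq (S ∪ T) t c q' Φ W N) (hG : G.IsFinConnected)
    (hrep : G.IsReplacing S T t q c Φ) (htq : t ≤ q) (hqq' : q ≤ q')
    (I : Finset ℕ) (hI : ∀ m ∈ I, m < N)
    (hS : (∀ m ∈ I, W m ∩ S = ∅) ∨ ∀ m ∈ I, S ⊆ W m)
    (hnest : ∀ a ∈ I, ∀ b ∈ I, W a ⊆ W b ∨ W b ⊆ W a) : I.card ≤ 3 * c + 2 := by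
  by_contra hcard
  have hSeq : ∀ a ∈ I, ∀ b ∈ I, W a ∩ S = W b ∩ S := by
    intro a ha b hb
    rcases hS with hS | hS
    · rw [hS a ha, hS b hb]
    · rw [Set.inter_eq_right.2 (hS a ha), Set.inter_eq_right.2 (hS b hb)]
  have hne : ∀ a ∈ I, ∀ b ∈ I, a ≠ b → W a ≠ W b := by
    intro a ha b hb hab heq
    have := h.disjoint_of_ne hab (hI a ha) (hI b hb)
    rw [heq, disjoint_self] at this
    exact (h.nonempty_cutSet (hI b hb)).ne_empty this
  obtain ⟨g, hgI, hg⟩ := exists_enum_of_chain (f := W) I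
    (fun m hm => hG.finite_of_subset (h.subset (hI m hm)))
    (fun a ha b hb hab => (hnest a ha b hb).imp
      (fun hs => hs.ssubset_of_ne (hne a ha b hb hab))
      (fun hs => hs.ssubset_of_ne (hne b hb a ha hab.symm)))
  have hgI' : ∀ a < 3 * c + 3, g a ∈ I := fun a ha => hgI a (by omega)
  have hg' : ∀ a b, a < b → b < 3 * c + 3 → W (g a) ⊂ W (g b) := fun a b hab hb =>
    hg a b hab (by omega)
  have hgle : ∀ a b, a ≤ b → b < 3 * c + 3 → W (g a) ⊆ W (g b) := fun a b hab hb => by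
    rcases hab.eq_or_lt with rfl | hab
    · exact subset_rfl
    · exact (hg' a b hab hb).subset
  have hgne : ∀ a b, a < b → b < 3 * c + 3 → g a ≠ g b := fun a b hab hb heq =>
    (hg' a b hab hb).ne (by rw [heq])
  have hslot : ∀ a, a + 1 < 3 * c + 3 → ((W (g (a + 1)) \ W (g a)) ∩ T).Nonempty := fun a ha =>
    h.sdiff_inter_nonempty (htq.trans hqq') (hI _ (hgI' a (by omega))) (hI _ (hgI' _ ha))
      (hgne a _ (by omega) ha) (hgle a _ (by omega) ha)
      (hSeq _ (hgI' a (by omega)) _ (hgI' _ ha))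
  have hcoh : ∀ a < 3 * c + 3, G.IsCoherent Φ (W (g a)) := fun a ha =>
    (h.coherent _ (hI _ (hgI' a ha))).mono subset_addCuts
  have hrig : ∀ a < 3 * c + 3, G.IsRigid (S ∪ T) q' Φ (W (g a)) := fun a ha =>
    (h.isRigid hG (hI _ (hgI' a ha))).mono subset_addCuts
  have hcand := fun a (ha : a < 3 * c + 3) => h.candidate _ (hI _ (hgI' a ha))
  have hdis : ∀ a b, a < b → b < 3 * c + 3 →
      Disjoint (G.cutSet (W (g a))) (G.cutSet (W (g b))) := fun a b hab hb =>
    h.disjoint_of_ne (hgne a b hab hb) (hI _ (hgI' a (by omega))) (hI _ (hgI' b hb))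
  rcases hS with hS | hS
  -- With `∅` prepended the window can start at the smallest set; `c + 1` rings remain after it. It
  -- lies in a member, hence has at most `t` vertices.
  · let A : ℕ → Set α := fun a => if a = 0 then ∅ else W (g (a - 1))
    have hA0 : A 0 = ∅ := if_pos rfl
    have hAs : ∀ a, A (a + 1) = W (g a) := fun a => if_neg (by omega)
    refine hrep.chain_false hG (htq.trans hqq') hqq' (A := A) (i := 1) (j := 2 * c + 2)
      (k := 3 * c + 3) (by omega) (by omega) ?_ ?_ ?_ ?_ ?_ ?_ (Or.inl hA0) (Or.inr ⟨by omega, ?_⟩)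
      (hAs 0 ▸ hrig 0 (by omega)) (hAs (2 * c + 1) ▸ hrig (2 * c + 1) (by omega))
      (hAs 0 ▸ (hcand 0 (by omega)).cutSet_nonempty)
      (hAs (2 * c + 1) ▸ (hcand _ (by omega)).cutSet_nonempty)
      (hAs 0 ▸ (hcand 0 (by omega)).ncard_cutSet_le)
      (hAs (2 * c + 1) ▸ (hcand _ (by omega)).ncard_cutSet_le) ?_
    · rintro (_ | a) ha
      · rw [hA0]
        exact Set.empty_subset _
      · rw [hAs]
        exact (hcand a ha).subset
    · rintro (_ | a) (_ | b) hab hb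
      · exact subset_rfl
      · rw [hA0]
        exact Set.empty_subset _
      · omega
      · rw [hAs, hAs]
        exact hgle a b (by omega) (by omega)
    · rintro (_ | a) (_ | b) hab hb
      · omega
      · rw [hA0, cutSet_empty]
        exact Set.empty_disjoint _
      · omega
      · rw [hAs, hAs]
        exact hdis a b (by omega) (by omega)
    · rintro (_ | a) ha
      · rw [hA0]
        exact isCoherent_of_cutSet_eq_empty (cutSet_empty G)
      · rw [hAs]
        exact hcoh a (by omega)
    · rw [hA0, hAs, Set.sdiff_empty, Set.disjoint_iff_inter_eq_empty]
      exact hS _ (hgI' _ (by omega))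
    · rintro (_ | a) h1 h2
      · omega
      · rw [hAs, hAs]
        exact hslot a (by omega)
    · rintro (_ | a) h1 h2
      · omega
      · rw [hAs, hAs]
        exact hslot a (by omega)
    · rw [hAs, hAs]
      exact (Set.ncard_le_ncard Set.sdiff_subset
        (hG.finite_of_subset (hcand _ (by omega)).subset)).trans (hcand _ (by omega)).ncard_le
  -- The mirror image: `V(G)` is appended, and the `c + 1` spare rings precede the window.
  · let A : ℕ → Set α := fun a => if a < 3 * c + 3 then W (g a) else V(G)
    have hAV : A (3 * c + 3) = V(G) := if_neg (by omega)
    have hAs : ∀ a < 3 * c + 3, A a = W (g a) := fun a ha => if_pos ha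
    have hc1 : c + 1 < 3 * c + 3 := by omega
    have hc2 : 3 * c + 2 < 3 * c + 3 := by omega
    refine hrep.chain_false hG (htq.trans hqq') hqq' (A := A) (i := c + 1) (j := 3 * c + 2)
      (k := 3 * c + 3) (by omega) (by omega) ?_ ?_ ?_ ?_ ?_ ?_ (Or.inr ⟨le_rfl, ?_⟩) (Or.inl hAV)
      (hAs _ hc1 ▸ hrig _ hc1) (hAs _ hc2 ▸ hrig _ hc2)
      (hAs _ hc1 ▸ (hcand _ hc1).cutSet_nonempty) (hAs _ hc2 ▸ (hcand _ hc2).cutSet_nonempty)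
      (hAs _ hc1 ▸ (hcand _ hc1).ncard_cutSet_le) (hAs _ hc2 ▸ (hcand _ hc2).ncard_cutSet_le) ?_
    · intro a ha
      rcases ha.eq_or_lt with rfl | ha
      · rw [hAV]
      · rw [hAs a ha]
        exact (hcand a ha).subset
    · intro a b hab hb
      rcases hb.eq_or_lt with rfl | hb
      · rw [hAV]
        rcases hab.eq_or_lt with rfl | ha
        · rw [hAV]
        · rw [hAs a ha]
          exact (hcand a ha).subset
      · rw [hAs a (by omega), hAs b hb]
        exact hgle a b hab hb
    · intro a b hab hb
      rcases hb.eq_or_lt with rfl | hb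
      · rw [hAV, cutSet_vertexSet]
        exact Set.disjoint_empty _
      · rw [hAs a (by omega), hAs b hb]
        exact hdis a b hab hb
    · intro a ha
      rcases ha.eq_or_lt with rfl | ha
      · rw [hAV]
        exact isCoherent_of_cutSet_eq_empty (cutSet_vertexSet G)
      · rw [hAs a ha]
        exact hcoh a ha
    · rw [hAs 0 (by omega), Set.disjoint_left]
      exact fun x hx hxS => hx.2 (hS _ (hgI' 0 (by omega)) hxS)
    · intro a h1 h2
      rw [hAs a (by omega), hAs (a + 1) (by omega)]
      exact hslot a (by omega)
    · intro a h2
      rw [hAs a (by omega), hAs (a + 1) (by omega)]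
      exact hslot a (by omega)
    · rw [hAs _ hc1, hAs _ hc2]
      exact (Set.ncard_le_ncard Set.sdiff_subset
        (hG.finite_of_subset (hcand _ (by omega)).subset)).trans (hcand _ (by omega)).ncard_le

end IsCutSeq

/-! ### Cuts that do not separate `S` -/

/-- To each member of a family of small rigid sets that avoid `S` one can assign an element of `S`
in such a way that disjoint sets get different elements. -/
theorem IsReplacing.exists_assignment [Nonempty α] (hrep : G.IsReplacing S T t q c Φ) (hG : G.IsFinConnected)
    (htq : t ≤ q) (hqq' : q ≤ q') {ι : Type*} (I : Set ι) (H : ι → Set α)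
    (hV : ∀ m ∈ I, H m ⊆ V(G)) (hS : ∀ m ∈ I, Disjoint (H m) S) (ht : ∀ m ∈ I, (H m).ncard ≤ t)
    (hT : ∀ m ∈ I, (H m ∩ T).Nonempty) (hne : ∀ m ∈ I, (G.cutSet (H m)).Nonempty)
    (hc : ∀ m ∈ I, (G.cutSet (H m)).ncard ≤ c)
    (hrig : ∀ m ∈ I, G.IsRigid (S ∪ T) q' Φ (H m)) :
    ∃ s : ι → α, (∀ m ∈ I, s m ∈ S) ∧
      ∀ a ∈ I, ∀ b ∈ I, s a = s b → (H a ∩ H b).Nonempty := by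
  classical
  let 𝒵 : ι → Set (Set α) := fun m =>
    {Z | Z ⊆ V(G) ∧ Z ∩ T = H m ∩ T ∧ Z.ncard ≤ q ∧ G.cutSet Z ⊆ Φ}
  -- Lexicographic order by cut size, then by number of vertices, which is at most `q`.
  let f : Set α → ℕ := fun Z => (G.cutSet Z).ncard * (q + 1) + Z.ncard
  have hex : ∀ m ∈ I, ∃ Z ∈ 𝒵 m, (∀ Z' ∈ 𝒵 m, f Z ≤ f Z') ∧
      (G.cutSet Z).ncard ≤ (G.cutSet (H m)).ncard := by
    intro m hm
    obtain ⟨Z₀, h1, h2, h3, h4, h5⟩ := hrep (H m) (hV m hm) (hS m hm) (ht m hm)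
      (by have := hc m hm; omega) (hT m hm)
    obtain ⟨Z, hZ, hmin⟩ := (measure f).wf.has_min (𝒵 m) ⟨Z₀, h1, h2, h3, h4⟩
    have hmin' : ∀ Z' ∈ 𝒵 m, f Z ≤ f Z' := fun Z' hZ' => not_lt.1 (hmin Z' hZ')
    refine ⟨Z, hZ, hmin', ?_⟩
    by_contra hlt
    have h6 := hmin' Z₀ ⟨h1, h2, h3, h4⟩
    have h7 : ((G.cutSet (H m)).ncard + 1) * (q + 1) ≤ (G.cutSet Z).ncard * (q + 1) :=
      Nat.mul_le_mul_right _ (by omega)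
    have h8 : (G.cutSet Z₀).ncard * (q + 1) ≤ (G.cutSet (H m)).ncard * (q + 1) :=
      Nat.mul_le_mul_right _ h5
    rw [add_mul, one_mul] at h7
    simp only [f] at h6
    omega
  choose! Z hZ hZmin hZle using hex
  have hfin : ∀ m ∈ I, (Z m).Finite := fun m hm => hG.finite_of_subset (hZ m hm).1
  -- If `Z m` avoided `S`, it would have the trace of `H m` on `S ∪ T`, and rigidity would make its
  -- cut larger than `∂(H m)`.
  have hZS : ∀ m ∈ I, ∃ s, s ∈ Z m ∧ s ∈ S := by
    intro m hm
    by_contra hno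
    push Not at hno
    obtain ⟨h1, h2, h3, h4⟩ := hZ m hm
    have := (hrig m hm).ncard_lt hG (hne m hm) h1 (by
        rw [Set.inter_union_distrib_left, Set.inter_union_distrib_left, h2,
          Set.disjoint_iff_inter_eq_empty.1 (hS m hm),
          Set.disjoint_iff_inter_eq_empty.1 (Set.disjoint_left.2 hno)])
      ((Set.ncard_le_ncard Set.sdiff_subset (hfin m hm)).trans (h3.trans hqq'))
      ((Set.ncard_le_ncard Set.sdiff_subset (hG.finite_of_subset (hV m hm))).trans
        ((ht m hm).trans (htq.trans hqq'))) h4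
    exact absurd (hZle m hm) (not_le.2 this)
  choose! s hsZ hsS using hZS
  refine ⟨s, hsS, fun a ha b hb hab => ?_⟩
  by_contra hno
  rw [Set.not_nonempty_iff_eq_empty] at hno
  have hmem : ∀ x ∈ T, x ∈ Z a → x ∉ Z b := by
    intro x hx hxa hxb
    have h1 : x ∈ H a ∩ T := (hZ a ha).2.1 ▸ ⟨hxa, hx⟩
    have h2 : x ∈ H b ∩ T := (hZ b hb).2.1 ▸ ⟨hxb, hx⟩
    exact (hno ▸ (⟨h1.1, h2.1⟩ : x ∈ H a ∩ H b) : x ∈ (∅ : Set α))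
  have hsub : ∀ a' ∈ I, ∀ b' ∈ I, (∀ x ∈ T, x ∈ Z a' → x ∉ Z b') → Z a' \ Z b' ∈ 𝒵 a' := by
    intro a' ha' b' hb' hd
    obtain ⟨h1, h2, h3, h4⟩ := hZ a' ha'
    refine ⟨Set.sdiff_subset.trans h1, ?_,
      (Set.ncard_le_ncard Set.sdiff_subset (hfin a' ha')).trans h3,
      (cutSet_sdiff_subset _ _ _).trans (Set.union_subset h4 (hZ b' hb').2.2.2)⟩
    rw [← h2]
    ext x
    have := hd x
    simp only [Set.mem_inter_iff, Set.mem_sdiff]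
    tauto
  -- Uncrossing: as `H a` and `H b` are disjoint, both differences are still admissible. By
  -- posimodularity their cuts are no larger in total, while losing the shared element of `S` makes
  -- the sets strictly smaller, against the two minimal choices.
  have h1 := hZmin a ha _ (hsub a ha b hb hmem)
  have h2 := hZmin b hb _ (hsub b hb a ha fun x hx h h' => hmem x hx h' h)
  have h3 := hG.posimodular (Z a) (Z b)
  have h4 := Nat.mul_le_mul_right (q + 1) h3
  have h5 : (Z a \ Z b).ncard < (Z a).ncard := Set.ncard_lt_ncard
    (Set.ssubset_iff_exists.2 ⟨Set.sdiff_subset, s a, hsZ a ha,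
      fun h' => h'.2 (hab ▸ hsZ b hb)⟩) (hfin a ha)
  have h6 : (Z b \ Z a).ncard ≤ (Z b).ncard := Set.ncard_le_ncard Set.sdiff_subset (hfin b hb)
  simp only [f] at h1 h2
  rw [add_mul, add_mul] at h4
  omega

/-- A set of indices is small if it is mapped to a finite set with small fibres. -/
theorem card_le_mul_ncard_of_fibre {ι γ : Type*} (I : Finset ι) {S : Set γ} (hS : S.Finite)
    (s : ι → γ) (hs : ∀ a ∈ I, s a ∈ S) (k : ℕ)
    (hk : ∀ J ⊆ I, (∀ a ∈ J, ∀ b ∈ J, s a = s b) → J.card ≤ k) :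
    I.card ≤ S.ncard * k := by
  classical
  rw [Set.ncard_eq_toFinset_card S hS, mul_comm]
  refine Finset.card_le_mul_card_image_of_maps_to (f := s) (fun a ha => by simpa using hs a ha) k
    fun b _ => hk _ (Finset.filter_subset _ _) fun a ha a' ha' => ?_
  rw [(Finset.mem_filter.1 ha).2, (Finset.mem_filter.1 ha').2]

namespace IsCutSeq

/-- Sets charged to the same element of `S` intersect. They cannot cover `V(G)`, since they miss
that element, so they are nested. -/
theorem card_le_of_disjoint (h : G.IsCutSeq (S ∪ T) t c q' Φ W N) (hG : G.IsFinConnected)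
    (hrep : G.IsReplacing S T t q c Φ) (htq : t ≤ q) (hqq' : q ≤ q') (hSV : S ⊆ V(G))
    (I : Finset ℕ) (hI : ∀ m ∈ I, m < N) (hS : ∀ m ∈ I, W m ∩ S = ∅) :
    I.card ≤ S.ncard * (3 * c + 2) := by
  rcases I.eq_empty_or_nonempty with rfl | ⟨m₀, hm₀⟩
  · simp
  have : Nonempty α := ⟨(h.candidate m₀ (hI m₀ hm₀)).trace_nonempty.some⟩
  obtain ⟨s, hsS, hs⟩ := hrep.exists_assignment hG htq hqq' {m | m ∈ I} W
    (fun m hm => h.subset (hI m hm)) (fun m hm => Set.disjoint_iff_inter_eq_empty.2 (hS m hm))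
    (fun m hm => (h.candidate m (hI m hm)).ncard_le)
    (fun m hm => by
      have := (h.candidate m (hI m hm)).trace_nonempty
      rwa [Set.inter_union_distrib_left, hS m hm, Set.empty_union] at this)
    (fun m hm => h.nonempty_cutSet (hI m hm))
    (fun m hm => (h.candidate m (hI m hm)).ncard_cutSet_le)
    (fun m hm => (h.isRigid hG (hI m hm)).mono subset_addCuts)
  refine card_le_mul_ncard_of_fibre I (hG.finite_of_subset hSV) s hsS _ fun J hJ hJs => ?_
  refine h.card_le_of_nested hG hrep htq hqq' J (fun m hm => hI m (hJ hm))
    (Or.inl fun m hm => hS m (hJ hm)) fun a ha b hb => ?_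
  have hab := hs a (hJ ha) b (hJ hb) (hJs a ha b hb)
  rcases h.nested_or_disjoint_or_cover' hG hrep htq hqq' (hI a (hJ ha)) (hI b (hJ hb))
    ((hS a (hJ ha)).trans (hS b (hJ hb)).symm) with h' | h' | h' | h'
  · exact Or.inl h'
  · exact Or.inr h'
  · exact absurd h' (Set.not_disjoint_iff_nonempty_inter.2 hab)
  · have hsa := hsS a (hJ ha)
    rcases h' (hSV hsa) with h'' | h''
    · exact absurd (Set.mem_inter h'' hsa) (by rw [hS a (hJ ha)]; exact Set.notMem_empty _)
    · exact absurd (Set.mem_inter h'' hsa) (by rw [hS b (hJ hb)]; exact Set.notMem_empty _)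

/-- The complement of `W m` lies in some `W p`, so it is small; it also avoids `S` and can be
charged to an element of `S`. Sets whose complements share a vertex do not cover `V(G)`, and as both
contain `S` they are nested. -/
theorem card_le_of_cover (h : G.IsCutSeq (S ∪ T) t c q' Φ W N) (hG : G.IsFinConnected)
    (hrep : G.IsReplacing S T t q c Φ) (htq : t ≤ q) (hqq' : q ≤ q') (h2t : 2 * t ≤ q')
    (hSV : S ⊆ V(G)) (hSne : S.Nonempty) (I : Finset ℕ) (hI : ∀ m ∈ I, m < N)
    (hS : ∀ m ∈ I, S ⊆ W m) (hcov : ∀ m ∈ I, ∃ p < N, V(G) ⊆ W m ∪ W p) :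
    I.card ≤ S.ncard * (3 * c + 2) := by
  have : Nonempty α := ⟨hSne.some⟩
  have hcl : ∀ m, ∀ ⦃e x y⦄, G.IsLink e x y → x ∈ V(G) \ W m → y ∉ V(G) \ W m → y ∈ W m :=
    fun m e x y hl _ hy => by_contra fun hyW => hy ⟨hl.right_mem, hyW⟩
  have hcut : ∀ m, G.cutSet (V(G) \ W m) = G.cutSet (W m) := fun m => cutSet_sdiff_vertexSet _ _
  obtain ⟨s, hsS, hs⟩ := hrep.exists_assignment hG htq hqq' {m | m ∈ I} (fun m => V(G) \ W m)
    (fun m hm => Set.sdiff_subset)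
    (fun m hm => Set.disjoint_left.2 fun x hx hxS => hx.2 (hS m hm hxS))
    (fun m hm => by
      obtain ⟨p, hp, hVp⟩ := hcov m hm
      refine (Set.ncard_le_ncard ?_ (hG.finite_of_subset (h.subset hp))).trans
        (h.candidate p hp).ncard_le
      exact fun x hx => (hVp hx.1).resolve_left hx.2)
    (fun m hm => by
      rw [Set.nonempty_iff_ne_empty]
      intro hE
      obtain ⟨p, hp, hVp⟩ := hcov m hm
      -- If the complement had no terminal, `V(G)` itself, with at most `2t ≤ q'` vertices and an
      -- empty cut, would compete with `W m`.
      have hVc : V(G).ncard ≤ 2 * t := by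
        refine (Set.ncard_le_ncard hVp ((hG.finite_of_subset (h.subset (hI m hm))).union
          (hG.finite_of_subset (h.subset hp)))).trans ((Set.ncard_union_le _ _).trans ?_)
        have := (h.candidate p hp).ncard_le
        have := (h.candidate m (hI m hm)).ncard_le
        omega
      have := (h.minimal m (hI m hm) V(G) subset_rfl (by
        refine Set.Subset.antisymm (fun x hx => ⟨?_, hx.2⟩)
          (Set.inter_subset_inter_left _ (h.subset (hI m hm)))
        rcases hx.2 with hxS | hxT
        · exact hS m hm hxS
        · by_contra hxW
          exact (hE ▸ (⟨⟨hx.1, hxW⟩, hxT⟩ : x ∈ (V(G) \ W m) ∩ T) : x ∈ (∅ : Set α)))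
        (by omega) (by rw [cutSet_vertexSet, Set.ncard_empty]; exact Nat.zero_le _)).1
      rw [cutSet_vertexSet, Set.ncard_empty] at this
      exact (h.nonempty_cutSet (hI m hm)).ne_empty
        ((Set.ncard_eq_zero (hG.finite_cutSet _)).1 this.symm))
    (fun m hm => hcut m ▸ h.nonempty_cutSet (hI m hm))
    (fun m hm => hcut m ▸ (h.candidate m (hI m hm)).ncard_cutSet_le)
    (fun m hm => ((h.isRigid hG (hI m hm)).mono subset_addCuts).of_closed hG
      (h.subset (hI m hm)) subset_rfl (hcl m))
  refine card_le_mul_ncard_of_fibre I (hG.finite_of_subset hSV) s hsS _ fun J hJ hJs => ?_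
  refine h.card_le_of_nested hG hrep htq hqq' J (fun m hm => hI m (hJ hm))
    (Or.inr fun m hm => hS m (hJ hm)) fun a ha b hb => ?_
  obtain ⟨x, hxa, hxb⟩ := hs a (hJ ha) b (hJ hb) (hJs a ha b hb)
  rcases h.nested_or_disjoint_or_cover' hG hrep htq hqq' (hI a (hJ ha)) (hI b (hJ hb))
    (by rw [Set.inter_eq_right.2 (hS a (hJ ha)), Set.inter_eq_right.2 (hS b (hJ hb))])
    with h' | h' | h' | h'
  · exact Or.inl h'
  · exact Or.inr h'
  · obtain ⟨y, hy⟩ := hSne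
    exact absurd (hS b (hJ hb) hy) (Set.disjoint_left.1 h' (hS a (hJ ha) hy))
  · exact ((h' hxa.1).elim hxa.2 hxb.2).elim

/-- Members that cover `V(G)` together with no other member are pairwise nested, because the
nonempty set `S` lies in all of them. -/
theorem card_le_of_superset (h : G.IsCutSeq (S ∪ T) t c q' Φ W N) (hG : G.IsFinConnected)
    (hrep : G.IsReplacing S T t q c Φ) (htq : t ≤ q) (hqq' : q ≤ q') (h2t : 2 * t ≤ q')
    (hSV : S ⊆ V(G)) (hSne : S.Nonempty) (I : Finset ℕ) (hI : ∀ m ∈ I, m < N)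
    (hS : ∀ m ∈ I, S ⊆ W m) :
    I.card ≤ S.ncard * (3 * c + 2) + (3 * c + 2) := by
  classical
  rw [← Finset.card_filter_add_card_filter_not (s := I) (fun m => ∃ p < N, V(G) ⊆ W m ∪ W p)]
  refine add_le_add ?_ ?_
  · exact h.card_le_of_cover hG hrep htq hqq' h2t hSV hSne _
      (fun m hm => hI m (Finset.mem_filter.1 hm).1) (fun m hm => hS m (Finset.mem_filter.1 hm).1)
      (fun m hm => (Finset.mem_filter.1 hm).2)
  · refine h.card_le_of_nested hG hrep htq hqq' _ (fun m hm => hI m (Finset.mem_filter.1 hm).1)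
      (Or.inr fun m hm => hS m (Finset.mem_filter.1 hm).1) fun a ha b hb => ?_
    have ha' := Finset.mem_filter.1 ha
    have hb' := Finset.mem_filter.1 hb
    rcases h.nested_or_disjoint_or_cover' hG hrep htq hqq' (hI a ha'.1) (hI b hb'.1)
      (by rw [Set.inter_eq_right.2 (hS a ha'.1), Set.inter_eq_right.2 (hS b hb'.1)])
      with h' | h' | h' | h'
    · exact Or.inl h'
    · exact Or.inr h'
    · obtain ⟨y, hy⟩ := hSne
      exact absurd (hS b hb'.1 hy) (Set.disjoint_left.1 h' (hS a ha'.1 hy))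
    · exact absurd ⟨b, hI b hb'.1, h'⟩ ha'.2

end IsCutSeq

/-! ### Families of sets without crossings -/

/-- Induction on `S`: deleting `x` identifies only pairs `A`, `A \ {x}`, laminarity allows one such
pair, and the empty set may arise once. So each element accounts for at most two sets. -/
theorem card_le_of_laminar {γ : Type*} {S : Set γ} (hS : S.Finite) (F : Finset (Set γ))
    (hsub : ∀ A ∈ F, A ⊆ S) (hne : ∅ ∉ F)
    (hlam : ∀ A ∈ F, ∀ B ∈ F, A ⊆ B ∨ B ⊆ A ∨ Disjoint A B) : F.card ≤ 2 * S.ncard := by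
  classical
  induction S, hS using Set.Finite.induction_on generalizing F with
  | empty =>
    have : F = ∅ := Finset.eq_empty_of_forall_notMem fun A hA =>
      hne (Set.subset_empty_iff.1 (hsub A hA) ▸ hA)
    simp [this]
  | @insert x S' hx hS' ih =>
    rw [Set.ncard_insert_of_notMem hx hS']
    have hF' := ih ((F.image (· \ {x})).erase ∅) (fun A hA => by
        obtain ⟨B, hB, rfl⟩ := Finset.mem_image.1 (Finset.mem_of_mem_erase hA)
        exact fun y hy => (hsub B hB hy.1).resolve_left hy.2)
      (Finset.notMem_erase _ _) (fun A hA B hB => by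
        obtain ⟨A', hA', rfl⟩ := Finset.mem_image.1 (Finset.mem_of_mem_erase hA)
        obtain ⟨B', hB', rfl⟩ := Finset.mem_image.1 (Finset.mem_of_mem_erase hB)
        rcases hlam A' hA' B' hB' with h | h | h
        · exact Or.inl (Set.sdiff_subset_sdiff_left h)
        · exact Or.inr (Or.inl (Set.sdiff_subset_sdiff_left h))
        · exact Or.inr (Or.inr (h.mono Set.sdiff_subset Set.sdiff_subset)))
    have h1 : (F.image (· \ {x})).card ≤ ((F.image (· \ {x})).erase ∅).card + 1 :=
      Nat.sub_le_iff_le_add.1 Finset.pred_card_le_card_erase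
    have h2 : (F.filter fun A => x ∈ A ∧ A \ {x} ∈ F).card ≤ 1 := by
      have key : ∀ A ∈ F, ∀ B ∈ F, x ∈ A → A \ {x} ∈ F → x ∈ B → B \ {x} ∈ F → A ⊆ B → A = B := by
        intro A hA B hB hxA hA' hxB hB' hAB
        refine hAB.antisymm ?_
        rcases hlam A hA _ hB' with h | h | h
        · exact absurd rfl (h hxA).2
        · intro y hy
          by_cases hyx : y = x
          · exact hyx ▸ hxA
          · exact h ⟨hy, hyx⟩
        · obtain ⟨y, hy⟩ := Set.nonempty_iff_ne_empty.2 (fun h0 => hne (h0 ▸ hA'))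
          exact absurd ⟨hAB hy.1, hy.2⟩ (Set.disjoint_left.1 h hy.1)
      refine Finset.card_le_one.2 fun A hA B hB => ?_
      obtain ⟨hA, hxA, hA'⟩ := Finset.mem_filter.1 hA
      obtain ⟨hB, hxB, hB'⟩ := Finset.mem_filter.1 hB
      rcases hlam A hA B hB with h | h | h
      · exact key A hA B hB hxA hA' hxB hB' h
      · exact (key B hB A hA hxB hB' hxA hA' h).symm
      · exact absurd hxB (Set.disjoint_left.1 h hxA)
    have h3 : (F.filter fun A => ¬(x ∈ A ∧ A \ {x} ∈ F)).card ≤ (F.image (· \ {x})).card := by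
      refine Finset.card_le_card_of_injOn (· \ {x})
        (fun A hA => Finset.mem_image_of_mem _ (Finset.mem_filter.1 hA).1) fun A hA B hB hAB => ?_
      obtain ⟨hA, hA'⟩ := Finset.mem_filter.1 hA
      obtain ⟨hB, hB'⟩ := Finset.mem_filter.1 hB
      have hAB : A \ {x} = B \ {x} := hAB
      by_cases hxA : x ∈ A <;> by_cases hxB : x ∈ B
      · rw [← Set.insert_sdiff_self_of_mem hxA, hAB, Set.insert_sdiff_self_of_mem hxB]
      · exact absurd ⟨hxA, by rw [hAB, Set.sdiff_singleton_eq_self hxB]; exact hB⟩ hA'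
      · exact absurd ⟨hxB, by rw [← hAB, Set.sdiff_singleton_eq_self hxA]; exact hA⟩ hB'
      · rwa [Set.sdiff_singleton_eq_self hxA, Set.sdiff_singleton_eq_self hxB] at hAB
    have h4 := Finset.card_filter_add_card_filter_not (s := F) (fun A => x ∈ A ∧ A \ {x} ∈ F)
    omega

/-- For a fixed `s ∈ S`, the members missing `s` are laminar, and so are the complements of those
containing it. -/
theorem card_le_of_crossFree {γ : Type*} {S : Set γ} (hS : S.Finite) (F : Finset (Set γ))
    (hsub : ∀ A ∈ F, A ⊆ S) (hne : ∅ ∉ F) (hSF : S ∉ F)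
    (hcf : ∀ A ∈ F, ∀ B ∈ F, A ⊆ B ∨ B ⊆ A ∨ Disjoint A B ∨ S ⊆ A ∪ B) :
    F.card ≤ 4 * S.ncard := by
  classical
  rcases S.eq_empty_or_nonempty with rfl | ⟨s, hs⟩
  · have : F = ∅ := Finset.eq_empty_of_forall_notMem fun A hA =>
      hne (Set.subset_empty_iff.1 (hsub A hA) ▸ hA)
    simp [this]
  have h1 := card_le_of_laminar hS (F.filter (s ∉ ·)) (fun A hA => hsub A (Finset.mem_filter.1 hA).1)
    (fun h => hne (Finset.mem_filter.1 h).1) (fun A hA B hB => by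
      obtain ⟨hA, hsA⟩ := Finset.mem_filter.1 hA
      obtain ⟨hB, hsB⟩ := Finset.mem_filter.1 hB
      rcases hcf A hA B hB with h | h | h | h
      · exact Or.inl h
      · exact Or.inr (Or.inl h)
      · exact Or.inr (Or.inr h)
      · exact ((h hs).elim hsA hsB).elim)
  have h2 := card_le_of_laminar hS ((F.filter (s ∈ ·)).image (S \ ·)) (fun A hA => by
      obtain ⟨B, -, rfl⟩ := Finset.mem_image.1 hA
      exact Set.sdiff_subset)
    (fun h => by
      obtain ⟨B, hB, hB0⟩ := Finset.mem_image.1 h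
      have hB := (Finset.mem_filter.1 hB).1
      exact hSF ((hsub B hB).antisymm (Set.sdiff_eq_empty.1 hB0) ▸ hB))
    (fun A hA B hB => by
      obtain ⟨A, hA', rfl⟩ := Finset.mem_image.1 hA
      obtain ⟨B, hB', rfl⟩ := Finset.mem_image.1 hB
      obtain ⟨hA, hsA⟩ := Finset.mem_filter.1 hA'
      obtain ⟨hB, hsB⟩ := Finset.mem_filter.1 hB'
      rcases hcf A hA B hB with h | h | h | h
      · exact Or.inr (Or.inl (Set.sdiff_subset_sdiff_right h))
      · exact Or.inl (Set.sdiff_subset_sdiff_right h)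
      · exact absurd hsB (Set.disjoint_left.1 h hsA)
      · exact Or.inr (Or.inr (Set.disjoint_left.2 fun x hx hx' =>
          (h hx.1).elim hx.2 hx'.2)))
  have hinj : Set.InjOn (S \ ·) (F.filter (s ∈ ·) : Set (Set γ)) := fun A hA B hB hAB => by
    have hA := hsub A (Finset.mem_filter.1 hA).1
    have hB := hsub B (Finset.mem_filter.1 hB).1
    have hAB : S \ A = S \ B := hAB
    rw [← Set.sdiff_sdiff_cancel_left hA, hAB, Set.sdiff_sdiff_cancel_left hB]
  rw [Finset.card_image_of_injOn hinj] at h2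
  have h3 := Finset.card_filter_add_card_filter_not (s := F) (s ∈ ·)
  omega

/-! ### Cuts that separate `S` -/

/-- `D` is a component of the complement of `W`, and both sets meet `S`. -/
structure IsBranch (G : Graph α β) (S W D : Set α) : Prop where
  subset : D ⊆ V(G) \ W
  closed : ∀ ⦃e x y⦄, G.IsLink e x y → x ∈ D → y ∉ D → y ∈ W
  unsplit : G.IsUnsplit D
  inter_nonempty : (D ∩ S).Nonempty
  inter_nonempty' : (W ∩ S).Nonempty

/-- A smallest set that contains a given `s ∈ S \ W` and is attached only to `W` is connected, since
a split would leave a smaller one. -/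
theorem IsFinConnected.exists_isBranch (hG : G.IsFinConnected) {W : Set α} (hSV : S ⊆ V(G))
    (hW : (W ∩ S).Nonempty) (hSW : ¬S ⊆ W) : ∃ D, G.IsBranch S W D := by
  obtain ⟨s, hs, hsW⟩ := Set.not_subset.1 hSW
  let 𝒟 : Set (Set α) := {D | D ⊆ V(G) \ W ∧ s ∈ D ∧
    ∀ ⦃e x y⦄, G.IsLink e x y → x ∈ D → y ∉ D → y ∈ W}
  have h𝒟 : 𝒟.Nonempty := ⟨V(G) \ W, subset_rfl, ⟨hSV hs, hsW⟩,
    fun e x y hl _ hy => by_contra fun hyW => hy ⟨hl.right_mem, hyW⟩⟩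
  obtain ⟨D, ⟨hDV, hsD, hcl⟩, hmin⟩ := (measure Set.ncard).wf.has_min 𝒟 h𝒟
  refine ⟨D, hDV, hcl, ?_, ⟨s, hsD, hs⟩, hW⟩
  have hDfin := hG.finite_of_subset (hDV.trans Set.sdiff_subset)
  intro Y a b ha haY hb hbY
  by_contra hno
  have hno' : ∀ ⦃e x y⦄, G.IsLink e x y → x ∈ D → y ∈ D → x ∈ Y → y ∈ Y := by
    intro e x y hl hx hy hxY
    by_contra hyY
    exact hno ⟨e, x, y, hl, hx, hy, hxY, hyY⟩
  by_cases hsY : s ∈ Y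
  · refine hmin (D ∩ Y) ⟨Set.inter_subset_left.trans hDV, ⟨hsD, hsY⟩, fun e x y hl hx hy => ?_⟩
      (Set.ncard_lt_ncard (Set.ssubset_iff_exists.2
        ⟨Set.inter_subset_left, b, hb, fun h => hbY h.2⟩) hDfin)
    exact hcl hl hx.1 fun hyD => hy ⟨hyD, hno' hl hx.1 hyD hx.2⟩
  · refine hmin (D \ Y) ⟨Set.sdiff_subset.trans hDV, ⟨hsD, hsY⟩, fun e x y hl hx hy => ?_⟩
      (Set.ncard_lt_ncard (Set.ssubset_iff_exists.2
        ⟨Set.sdiff_subset, a, ha, fun h => h.2 haY⟩) hDfin)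
    exact hcl hl hx.1 fun hyD => hy ⟨hyD, fun hyY => hx.2 (hno' hl.symm hyD hx.1 hyY)⟩

namespace IsBranch

variable {W D : Set α}

theorem cutSet_subset (hD : G.IsBranch S W D) : G.cutSet D ⊆ G.cutSet W := by
  rintro e ⟨x, y, hl, hx, hy⟩
  exact ⟨y, x, hl.symm, hD.closed hl hx hy, (hD.subset hx).2⟩

theorem subset_vertexSet (hD : G.IsBranch S W D) : D ⊆ V(G) := hD.subset.trans Set.sdiff_subset

theorem cutSet_nonempty (hD : G.IsBranch S W D) (hG : G.IsFinConnected) (hSV : S ⊆ V(G)) :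
    (G.cutSet D).Nonempty := by
  obtain ⟨x, hx, hxS⟩ := hD.inter_nonempty
  obtain ⟨y, hy, hyS⟩ := hD.inter_nonempty'
  exact hG.cutSet_nonempty (hSV hxS) (hSV hyS) hx fun h => (hD.subset h).2 hy

/-- The complement of a component of the complement of a connected set is connected. -/
theorem unsplit_compl (hD : G.IsBranch S W D) (hG : G.IsFinConnected) (hW : W ⊆ V(G))
    (hWu : G.IsUnsplit W) : G.IsUnsplit (V(G) \ D) := by
  intro Y a b ha haY hb hbY
  have hWD : ∀ x ∈ W, x ∈ V(G) \ D := fun x hx => ⟨hW hx, fun h => (hD.subset h).2 hx⟩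
  by_cases h1 : ∃ x ∈ W, x ∈ Y
  · by_cases h2 : ∃ y ∈ W, y ∉ Y
    · obtain ⟨x, hx, hxY⟩ := h1
      obtain ⟨y, hy, hyY⟩ := h2
      obtain ⟨e, u, v, hl, hu, hv, huY, hvY⟩ := hWu hx hxY hy hyY
      exact ⟨e, u, v, hl, hWD u hu, hWD v hv, huY, hvY⟩
    · push Not at h2
      obtain ⟨e, x, y, hl, hx, hy⟩ :=
        hG.exists_isLink (A := (V(G) \ D) \ Y) hb.1 ha.1 ⟨hb, hbY⟩ (fun h => h.2 haY)
      have hyD : y ∉ D := fun hyD => hx.2 (h2 x (hD.closed hl.symm hyD hx.1.2))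
      have hyY : y ∈ Y := by_contra fun hyY => hy ⟨⟨hl.right_mem, hyD⟩, hyY⟩
      exact ⟨e, y, x, hl.symm, ⟨hl.right_mem, hyD⟩, hx.1, hyY, hx.2⟩
  · push Not at h1
    obtain ⟨e, x, y, hl, hx, hy⟩ :=
      hG.exists_isLink (A := (V(G) \ D) ∩ Y) ha.1 hb.1 ⟨ha, haY⟩ (fun h => hbY h.2)
    have hyD : y ∉ D := fun hyD => h1 x (hD.closed hl.symm hyD hx.1.2) hx.2
    exact ⟨e, x, y, hl, hx.1, ⟨hl.right_mem, hyD⟩, hx.2, fun hyY => hy ⟨⟨hl.right_mem, hyD⟩, hyY⟩⟩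

end IsBranch

namespace IsCutSeq

variable {D D' : Set α}

/-- Coherence puts `∂(D')` on one side of `D`. Both `D` and its complement are connected, so the
other side is not divided by `D'`. -/
theorem branch_crossFree_of_lt (h : G.IsCutSeq (S ∪ T) t c q' Φ W N) (hG : G.IsFinConnected)
    (hlm : l < m) (hm : m < N) (hD : G.IsBranch S (W l) D) (hD' : G.IsBranch S (W m) D') :
    D ⊆ D' ∨ D' ⊆ D ∨ Disjoint D D' ∨ V(G) ⊆ D ∪ D' := by
  have hl := hlm.trans hm
  rcases (h.coherent m hm).of_cutSet_subset hD'.cutSet_subset D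
    (hD.cutSet_subset.trans (cutSet_subset_addCuts hlm)) with h1 | h1
  · by_cases h2 : ∃ a ∈ V(G) \ D, a ∈ D'
    · right; right; right
      intro b hb
      by_contra hbD
      rw [Set.mem_union, not_or] at hbD
      obtain ⟨a, ha, haD'⟩ := h2
      obtain ⟨e, x, y, hlk, hx, -, hxD', hyD'⟩ := hD.unsplit_compl hG (h.subset hl)
        (h.unsplit l hl) ha haD' ⟨hb, hbD.1⟩ hbD.2
      exact hx.2 (h1 hlk hxD' hyD').1
    · push Not at h2
      exact Or.inr (Or.inl fun x hx => by_contra fun hxD =>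
        h2 x ⟨hD'.subset_vertexSet hx, hxD⟩ hx)
  · by_cases hd : Disjoint D D'
    · exact Or.inr (Or.inr (Or.inl hd))
    left
    obtain ⟨a, ha, haD'⟩ := Set.not_disjoint_iff.1 hd
    intro b hb
    by_contra hbD'
    obtain ⟨e, x, y, hlk, hx, -, hxD', hyD'⟩ := hD.unsplit ha haD' hb hbD'
    exact (h1 hlk hxD' hyD').1 hx

theorem branch_crossFree (h : G.IsCutSeq (S ∪ T) t c q' Φ W N) (hG : G.IsFinConnected)
    (hne : l ≠ m) (hl : l < N) (hm : m < N) (hD : G.IsBranch S (W l) D)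
    (hD' : G.IsBranch S (W m) D') :
    D ⊆ D' ∨ D' ⊆ D ∨ Disjoint D D' ∨ V(G) ⊆ D ∪ D' := by
  rcases hne.lt_or_gt with hlt | hlt
  · exact h.branch_crossFree_of_lt hG hlt hm hD hD'
  · rcases h.branch_crossFree_of_lt hG hlt hl hD' hD with h' | h' | h' | h'
    · exact Or.inr (Or.inl h')
    · exact Or.inl h'
    · exact Or.inr (Or.inr (Or.inl h'.symm))
    · exact Or.inr (Or.inr (Or.inr (by rwa [Set.union_comm])))

/-- `W l` has vertices on both sides of `D'`: an element of `S` outside it, and an end of an edge of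
`∂(D)`, which stays in `D'` because the cuts are disjoint. If `l < m`, connectedness of `W l` and
coherence of `W m` conclude. If `m < l`, coherence puts `∂(W l)` inside `D'`, so `W l` contains
everything outside `D'`. -/
theorem branch_cutInside (h : G.IsCutSeq (S ∪ T) t c q' Φ W N) (hG : G.IsFinConnected)
    (hSV : S ⊆ V(G)) (hne : l ≠ m) (hl : l < N) (hm : m < N) (hD : G.IsBranch S (W l) D)
    (hD' : G.IsBranch S (W m) D') (hDD' : D ⊆ D') (hS : D ∩ S = D' ∩ S) :
    G.CutInside D' (W l) := by
  obtain ⟨s, hsW, hsS⟩ := hD.inter_nonempty'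
  have hsD' : s ∉ D' := fun h' => (hD.subset (hS ▸ (⟨h', hsS⟩ : s ∈ D' ∩ S) : s ∈ D ∩ S).1).2 hsW
  obtain ⟨e, x, y, hlk, hx, hy⟩ := hD.cutSet_nonempty hG hSV
  have hyW := hD.closed hlk hx hy
  have hxW := (hD.subset hx).2
  have hyD' : y ∈ D' := by
    by_contra hyD'
    exact Set.disjoint_left.1 (h.disjoint_of_ne hne hl hm) (hD.cutSet_subset ⟨x, y, hlk, hx, hy⟩)
      (hD'.cutSet_subset ⟨x, y, hlk, hDD' hx, hyD'⟩)
  rcases hne.lt_or_gt with hlt | hlt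
  · obtain ⟨e', u, v, hlk', hu, -, huD', hvD'⟩ := h.unsplit l hl hyW hyD' hsW hsD'
    refine ((h.coherent m hm).of_cutSet_subset hD'.cutSet_subset (W l)
      (cutSet_subset_addCuts hlt)).resolve_right fun h1 => ?_
    exact (h1 hlk' huD' hvD').1 hu
  · have h1 := (h.coherent l hl D'
      (hD'.cutSet_subset.trans (cutSet_subset_addCuts hlt))).resolve_right
      fun h1 => (h1 hlk.symm hyW hxW).1 hyD'
    have h2 : ∀ b ∈ V(G), b ∉ D' → b ∈ W l := by
      intro b hb hbD'
      by_contra hbW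
      obtain ⟨e', u, v, hlk', hu, -, huW, hvW⟩ := hD'.unsplit_compl hG (h.subset hm)
        (h.unsplit m hm) ⟨hSV hsS, hsD'⟩ hsW ⟨hb, hbD'⟩ hbW
      exact hu.2 (h1 hlk' huW hvW).1
    intro e' u v hlk' hu hv
    have hvW := h2 v hlk'.right_mem hv
    refine ⟨?_, hvW⟩
    by_contra huW
    exact hv (h1 hlk'.symm hvW huW).1

/-- Otherwise `D'` and `D' \ W l` have the same trace. The latter is a union of components of the
complement of `W l`, so both are rigid, and they differ by at most `t` vertices. Their cuts then
have equal size, and rigidity at the later index excludes the cut added earlier. -/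
theorem branch_sdiff_inter_nonempty (h : G.IsCutSeq (S ∪ T) t c q' Φ W N) (hG : G.IsFinConnected)
    (htq' : t ≤ q') (hSV : S ⊆ V(G)) (hne : l ≠ m) (hl : l < N) (hm : m < N)
    (hD : G.IsBranch S (W l) D) (hD' : G.IsBranch S (W m) D') (hDD' : D ⊆ D')
    (hS : D ∩ S = D' ∩ S) : ((D' \ D) ∩ T).Nonempty := by
  have hin := h.branch_cutInside hG hSV hne hl hm hD hD' hDD' hS
  rw [Set.nonempty_iff_ne_empty]
  intro hE
  have hDN : D ⊆ D' \ W l := fun x hx => ⟨hDD' hx, (hD.subset hx).2⟩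
  have hNcl : ∀ ⦃e x y⦄, G.IsLink e x y → x ∈ D' \ W l → y ∉ D' \ W l → y ∈ W l := by
    intro e x y hlk hx hy
    by_contra hyW
    exact hx.2 (hin hlk hx.1 fun hyD' => hy ⟨hyD', hyW⟩).1
  have hNV : D' \ W l ⊆ V(G) \ W l := Set.sdiff_subset_sdiff_left hD'.subset_vertexSet
  have hrN := (h.isRigid hG hl).of_closed hG (h.subset hl) hNV hNcl
  have hrD' := (h.isRigid hG hm).of_closed hG (h.subset hm) hD'.subset hD'.closed
  have hK : (D' \ W l) ∩ (S ∪ T) = D' ∩ (S ∪ T) := by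
    refine Set.Subset.antisymm (Set.inter_subset_inter_left _ Set.sdiff_subset) ?_
    rintro x ⟨hx, hxS | hxT⟩
    · exact ⟨hDN (hS ▸ (⟨hx, hxS⟩ : x ∈ D' ∩ S) : x ∈ D ∩ S).1, Or.inl hxS⟩
    · refine ⟨hDN ?_, Or.inr hxT⟩
      by_contra hxD
      exact (hE ▸ (⟨⟨hx, hxD⟩, hxT⟩ : x ∈ (D' \ D) ∩ T) : x ∈ (∅ : Set α))
  have hc1 : ((D' \ W l) \ D').ncard ≤ q' := by
    rw [Set.sdiff_eq_empty.2 Set.sdiff_subset, Set.ncard_empty]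
    exact Nat.zero_le _
  have hc2 : (D' \ (D' \ W l)).ncard ≤ q' := by
    refine (Set.ncard_le_ncard (t := W l) ?_ (hG.finite_of_subset (h.subset hl))).trans
      ((h.candidate l hl).ncard_le.trans htq')
    exact fun x hx => by_contra fun hxW => hx.2 ⟨hx.1, hxW⟩
  have hND' : (G.cutSet D').Nonempty := hD'.cutSet_nonempty hG hSV
  by_cases hle : (G.cutSet (D' \ W l)).ncard ≤ (G.cutSet D').ncard
  · obtain ⟨heq, hd⟩ := hrD' _ (hNV.trans Set.sdiff_subset) hK hc1 hc2 hle
    obtain ⟨-, hd'⟩ := hrN D' hD'.subset_vertexSet hK.symm hc2 hc1 heq.ge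
    rcases hne.lt_or_gt with hlt | hlt
    · have hsub : G.cutSet (D' \ W l) ⊆ G.addCuts Φ W m := by
        refine Set.Subset.trans ?_ (cutSet_subset_addCuts hlt)
        rintro e ⟨x, y, hlk, hx, hy⟩
        exact ⟨y, x, hlk.symm, hNcl hlk hx hy, hx.2⟩
      have h0 : G.cutSet (D' \ W l) = ∅ := Set.subset_empty_iff.1 (hd subset_rfl hsub)
      rw [h0, Set.ncard_empty] at heq
      exact hND'.ne_empty ((Set.ncard_eq_zero (hG.finite_cutSet _)).1 heq.symm)
    · exact hND'.ne_empty (Set.subset_empty_iff.1 (hd' subset_rfl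
        (hD'.cutSet_subset.trans (cutSet_subset_addCuts hlt))))
  · have := (hrN D' hD'.subset_vertexSet hK.symm hc2 hc1 (not_le.1 hle).le).1
    omega

/-- Branches with a common trace on `S` are few. -/
theorem card_le_of_branch_trace_eq (h : G.IsCutSeq (S ∪ T) t c q' Φ W N) (hG : G.IsFinConnected)
    (hrep : G.IsReplacing S T t q c Φ) (htq : t ≤ q) (hqq' : q ≤ q') (hSV : S ⊆ V(G))
    (D : ℕ → Set α) (I : Finset ℕ) (hI : ∀ m ∈ I, m < N)
    (hD : ∀ m ∈ I, G.IsBranch S (W m) (D m))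
    (hS : ∀ a ∈ I, ∀ b ∈ I, D a ∩ S = D b ∩ S) : I.card ≤ 2 * c ^ 2 + 3 * c + 2 := by
  by_contra hcard
  have hne : ∀ a ∈ I, ∀ b ∈ I, a ≠ b → D a ≠ D b := by
    intro a ha b hb hab heq
    have := (h.disjoint_of_ne hab (hI a ha) (hI b hb)).mono (hD a ha).cutSet_subset
      (hD b hb).cutSet_subset
    rw [heq, disjoint_self] at this
    exact ((hD b hb).cutSet_nonempty hG hSV).ne_empty this
  have hnest : ∀ a ∈ I, ∀ b ∈ I, a ≠ b → D a ⊆ D b ∨ D b ⊆ D a := by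
    intro a ha b hb hab
    rcases h.branch_crossFree hG hab (hI a ha) (hI b hb) (hD a ha) (hD b hb) with h' | h' | h' | h'
    · exact Or.inl h'
    · exact Or.inr h'
    · obtain ⟨x, hx⟩ := (hD a ha).inter_nonempty
      have hx' : x ∈ D b ∩ S := hS a ha b hb ▸ hx
      exact absurd hx'.1 (Set.disjoint_left.1 h' hx.1)
    · obtain ⟨x, hxW, hxS⟩ := (hD a ha).inter_nonempty'
      have hxa : x ∉ D a := fun hx => ((hD a ha).subset hx).2 hxW
      have hxb : x ∈ D b ∩ S := ⟨(h' (hSV hxS)).resolve_left hxa, hxS⟩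
      rw [← hS a ha b hb] at hxb
      exact absurd hxb.1 hxa
  obtain ⟨g, hgI, hg⟩ := exists_enum_of_chain (f := D) I
    (fun m hm => hG.finite_of_subset (hD m hm).subset_vertexSet)
    (fun a ha b hb hab => (hnest a ha b hb hab).imp
      (fun hs => hs.ssubset_of_ne (hne a ha b hb hab))
      (fun hs => hs.ssubset_of_ne (hne b hb a ha hab.symm)))
  -- Room for `c` consecutive windows of `2c + 1` rings, with `c + 1` spare rings on either side.
  -- Branches may be large, so a window with at most `t` vertices has to be found.
  obtain ⟨k, hk⟩ : ∃ k, k = c + 1 + c * (2 * c + 1) + (c + 1) := ⟨_, rfl⟩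
  have hkI : k < I.card := by nlinarith
  have hgle : ∀ a b, a ≤ b → b ≤ k → D (g a) ⊆ D (g b) := fun a b hab hb => by
    rcases hab.eq_or_lt with rfl | hab
    · exact subset_rfl
    · exact (hg a b hab (by omega)).subset
  have hgne : ∀ a b, a < b → b ≤ k → g a ≠ g b := fun a b hab hb heq =>
    (hg a b hab (by omega)).ne (by rw [heq])
  have hgI' : ∀ a ≤ k, g a ∈ I := fun a ha => hgI a (by omega)
  have hgN : ∀ a ≤ k, g a < N := fun a ha => hI _ (hgI' a ha)
  have hgD : ∀ a ≤ k, G.IsBranch S (W (g a)) (D (g a)) := fun a ha => hD _ (hgI' a ha)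
  have hslot : ∀ a < k, ((D (g (a + 1)) \ D (g a)) ∩ T).Nonempty := fun a ha =>
    h.branch_sdiff_inter_nonempty hG (htq.trans hqq') hSV (hgne a (a + 1) (by omega) ha)
      (hgN a ha.le) (hgN _ ha) (hgD a ha.le) (hgD _ ha) (hgle a _ (by omega) ha)
      (hS _ (hgI' a ha.le) _ (hgI' _ ha))
  have hrig : ∀ a ≤ k, G.IsRigid (S ∪ T) q' Φ (D (g a)) := fun a ha =>
    ((h.isRigid hG (hgN a ha)).mono subset_addCuts).of_closed hG (h.subset (hgN a ha))
      (hgD a ha).subset (hgD a ha).closed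
  have hcutc : ∀ a ≤ k, (G.cutSet (D (g a))).ncard ≤ c := fun a ha =>
    (Set.ncard_le_ncard (hgD a ha).cutSet_subset (hG.finite_cutSet _)).trans
      (h.candidate _ (hgN a ha)).ncard_cutSet_le
  have hck : c + 1 ≤ k := by omega
  have hrc : ∀ r < c, c + 1 + r * (2 * c + 1) + (2 * c + 1) + (c + 1) ≤ k := by
    intro r hr
    have := Nat.mul_le_mul_right (2 * c + 1) (Nat.succ_le_iff.2 hr)
    rw [Nat.succ_mul] at this
    omega
  -- a window contained in a member of the sequence
  obtain ⟨r, hr, hwin⟩ : ∃ r < c, D (g (c + 1 + r * (2 * c + 1) + (2 * c + 1))) \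
      D (g (c + 1 + r * (2 * c + 1))) ⊆ W (g (c + 1)) := by
    by_contra hno
    push Not at hno
    have hWD := hgD (c + 1) hck
    -- If every window left `W (g (c + 1))`, each would send an edge into that set, because the
    -- later branch cuts lie inside it by `branch_cutInside`. The branch `D (g (c + 1))` sends one
    -- more. These `c + 1` edges are distinct, but the cut has at most `c`.
    let Q : ℕ → Set α := fun r => if r < c then D (g (c + 1 + r * (2 * c + 1) + (2 * c + 1))) \
      D (g (c + 1 + r * (2 * c + 1))) else D (g (c + 1))
    have hQc : Q c = D (g (c + 1)) := if_neg (lt_irrefl c)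
    have hQlt : ∀ r < c, Q r = D (g (c + 1 + r * (2 * c + 1) + (2 * c + 1))) \
      D (g (c + 1 + r * (2 * c + 1))) := fun r hr => if_pos hr
    have hQ : ∀ r ≤ c, ∃ e x y, G.IsLink e x y ∧ x ∈ Q r ∧ x ∉ W (g (c + 1)) ∧
        y ∈ W (g (c + 1)) := by
      intro r hr
      rcases hr.eq_or_lt with hrc' | hr
      · obtain ⟨e, x, y, hlk, hx, hy⟩ := hWD.cutSet_nonempty hG hSV
        exact ⟨e, x, y, hlk, by rw [hrc', hQc]; exact hx, (hWD.subset hx).2,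
          hWD.closed hlk hx hy⟩
      · have hrk := hrc r hr
        obtain ⟨v, hv, hvW⟩ := Set.not_subset.1 (hno r hr)
        obtain ⟨s, hsW, hsS⟩ := hWD.inter_nonempty'
        have hQr := hQlt r hr
        obtain ⟨e, x, y, hlk, hx, hy⟩ := hG.exists_isLink (A := Q r \ W (g (c + 1)))
          ((hgD _ (by omega)).subset_vertexSet hv.1) (hSV hsS) ⟨hQr ▸ hv, hvW⟩ (fun h' => h'.2 hsW)
        refine ⟨e, x, y, hlk, hx.1, hx.2, ?_⟩
        by_contra hyW
        have hyQ : y ∉ Q r := fun h' => hy ⟨h', hyW⟩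
        have hxQ := hx.1
        rw [hQr] at hxQ hyQ
        by_cases hy2 : y ∈ D (g (c + 1 + r * (2 * c + 1) + (2 * c + 1)))
        · have hy1 : y ∈ D (g (c + 1 + r * (2 * c + 1))) := by_contra fun h' => hyQ ⟨hy2, h'⟩
          rcases Nat.eq_zero_or_pos (r * (2 * c + 1)) with h0 | h0
          · rw [h0] at hy1 hxQ
            exact hx.2 (hWD.closed hlk.symm hy1 hxQ.2)
          · exact hyW (h.branch_cutInside hG hSV (hgne _ _ (by omega) (by omega)) (hgN _ hck)
              (hgN _ (by omega)) hWD (hgD _ (by omega)) (hgle _ _ (by omega) (by omega))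
              (hS _ (hgI' _ hck) _ (hgI' _ (by omega))) hlk.symm hy1 hxQ.2).1
        · exact hyW (h.branch_cutInside hG hSV (hgne _ _ (by omega) (by omega)) (hgN _ hck)
              (hgN _ (by omega)) hWD (hgD _ (by omega)) (hgle _ _ (by omega) (by omega))
              (hS _ (hgI' _ hck) _ (hgI' _ (by omega))) hlk hxQ.1 hy2).2
    have hdisj : ∀ a b, a < b → b ≤ c → ∀ x ∈ Q a, x ∉ Q b := by
      intro a b hab hb x hxa hxb
      rw [hQlt a (hab.trans_le hb)] at hxa
      have hrk := hrc a (hab.trans_le hb)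
      rcases hb.eq_or_lt with hbc | hb
      · rw [hbc, hQc] at hxb
        exact hxa.2 (hgle _ _ (by omega) (by omega) hxb)
      · rw [hQlt b hb] at hxb
        have hrk' := hrc b hb
        have := Nat.mul_le_mul_right (2 * c + 1) (Nat.succ_le_iff.2 hab)
        rw [Nat.succ_mul] at this
        exact hxb.2 (hgle _ _ (by omega) (by omega) hxa.1)
    have : Nonempty β := ⟨(hQ 0 (Nat.zero_le _)).choose⟩
    have : Nonempty α := ⟨(hQ 0 (Nat.zero_le _)).choose_spec.choose⟩
    choose! e x y hlk hxQ hxW hyW using hQ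
    have hinj : Set.InjOn e (Finset.range (c + 1)) := by
      intro a ha b hb hab
      have ha := Nat.lt_succ_iff.1 (Finset.mem_range.1 ha)
      have hb := Nat.lt_succ_iff.1 (Finset.mem_range.1 hb)
      have hxx : x a = x b := by
        have := hlk b hb
        rw [← hab] at this
        rcases (hlk a ha).eq_and_eq_or_eq_and_eq this with h' | h'
        · exact h'.1
        · exact absurd (h'.1 ▸ hyW b hb) (hxW a ha)
      rcases lt_trichotomy a b with hlt | heq | hlt
      · exact absurd (hxx ▸ hxQ b hb) (hdisj a b hlt hb _ (hxQ a ha))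
      · exact heq
      · exact absurd (hxx ▸ hxQ a ha) (hdisj b a hlt ha _ (hxQ b hb))
    classical
    have hsub : ((Finset.range (c + 1)).image e : Set β) ⊆ G.cutSet (W (g (c + 1))) := by
      intro e' he'
      obtain ⟨a, ha, rfl⟩ := Finset.mem_image.1 (Finset.mem_coe.1 he')
      have ha := Nat.lt_succ_iff.1 (Finset.mem_range.1 ha)
      exact ⟨y a, x a, (hlk a ha).symm, hyW a ha, hxW a ha⟩
    have h1 := Set.ncard_le_ncard hsub (hG.finite_cutSet _)
    rw [Set.ncard_coe_finset, Finset.card_image_of_injOn hinj, Finset.card_range] at h1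
    have := (h.candidate _ (hgN _ hck)).ncard_cutSet_le
    omega
  have hrk := hrc r hr
  refine hrep.chain_false hG (htq.trans hqq') hqq' (A := fun a => D (g a))
    (i := c + 1 + r * (2 * c + 1)) (j := c + 1 + r * (2 * c + 1) + (2 * c + 1)) (k := k)
    (by omega) (by omega) (fun a ha => (hgD a ha).subset_vertexSet) hgle ?_ ?_ ?_
    (fun a _ ha => hslot a (by omega)) (Or.inr ⟨by omega, fun a ha => hslot a (by omega)⟩)
    (Or.inr ⟨by omega, fun a _ ha => hslot a ha⟩) (hrig _ (by omega)) (hrig _ (by omega))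
    ((hgD _ (by omega)).cutSet_nonempty hG hSV) ((hgD _ (by omega)).cutSet_nonempty hG hSV)
    (hcutc _ (by omega)) (hcutc _ (by omega)) ?_
  · intro a b hab hb
    exact (h.disjoint_of_ne (hgne a b hab hb) (hgN a (by omega)) (hgN b hb)).mono
      (hgD a (by omega)).cutSet_subset (hgD b hb).cutSet_subset
  · intro a ha
    exact ((h.coherent _ (hgN a ha)).mono subset_addCuts).of_cutSet_subset (hgD a ha).cutSet_subset
  · rw [Set.disjoint_left]
    intro x hx hxS
    have : x ∈ D (g 0) ∩ S := hS _ (hgI' k le_rfl) _ (hgI' 0 (by omega)) ▸ ⟨hx.1, hxS⟩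
    exact hx.2 this.1
  · exact (Set.ncard_le_ncard hwin (hG.finite_of_subset (h.subset (hgN _ hck)))).trans
      (h.candidate _ (hgN _ hck)).ncard_le

/-- Branches inherit a cross-free family of traces on `S`, none of them empty or all of `S`; the
fibres are bounded by `card_le_of_branch_trace_eq`. -/
theorem card_le_of_separating (h : G.IsCutSeq (S ∪ T) t c q' Φ W N) (hG : G.IsFinConnected)
    (hrep : G.IsReplacing S T t q c Φ) (htq : t ≤ q) (hqq' : q ≤ q') (hSV : S ⊆ V(G))
    (I : Finset ℕ) (hI : ∀ m ∈ I, m < N) (hS : ∀ m ∈ I, (W m ∩ S).Nonempty ∧ ¬S ⊆ W m) :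
    I.card ≤ 4 * S.ncard * (2 * c ^ 2 + 3 * c + 2) := by
  classical
  have hex : ∀ m ∈ I, ∃ D, G.IsBranch S (W m) D := fun m hm =>
    hG.exists_isBranch hSV (hS m hm).1 (hS m hm).2
  choose! D hD using hex
  have h1 : (I.image fun m => D m ∩ S).card ≤ 4 * S.ncard := by
    refine card_le_of_crossFree (hG.finite_of_subset hSV) _ (fun A hA => ?_) (fun hA => ?_)
      (fun hA => ?_) (fun A hA B hB => ?_)
    · obtain ⟨m, -, rfl⟩ := Finset.mem_image.1 hA
      exact Set.inter_subset_right
    · obtain ⟨m, hm, hm0⟩ := Finset.mem_image.1 hA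
      exact (hD m hm).inter_nonempty.ne_empty hm0
    · obtain ⟨m, hm, hmS⟩ := Finset.mem_image.1 hA
      obtain ⟨x, hxW, hxS⟩ := (hS m hm).1
      exact ((hD m hm).subset (Set.inter_eq_right.1 hmS hxS)).2 hxW
    · obtain ⟨a, ha, rfl⟩ := Finset.mem_image.1 hA
      obtain ⟨b, hb, rfl⟩ := Finset.mem_image.1 hB
      by_cases hab : a = b
      · exact Or.inl (by rw [hab])
      rcases h.branch_crossFree hG hab (hI a ha) (hI b hb) (hD a ha) (hD b hb)
        with h' | h' | h' | h'
      · exact Or.inl (Set.inter_subset_inter_left _ h')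
      · exact Or.inr (Or.inl (Set.inter_subset_inter_left _ h'))
      · exact Or.inr (Or.inr (Or.inl (h'.mono Set.inter_subset_left Set.inter_subset_left)))
      · refine Or.inr (Or.inr (Or.inr fun x hx => ?_))
        exact (h' (hSV hx)).imp (fun h => ⟨h, hx⟩) (fun h => ⟨h, hx⟩)
  have h2 := Finset.card_le_mul_card_image (s := I) (f := fun m => D m ∩ S)
    (2 * c ^ 2 + 3 * c + 2) (fun A _ => h.card_le_of_branch_trace_eq hG hrep htq hqq' hSV D _
      (fun m hm => hI m (Finset.mem_filter.1 hm).1) (fun m hm => hD m (Finset.mem_filter.1 hm).1)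
      (fun a ha b hb => (Finset.mem_filter.1 ha).2.trans (Finset.mem_filter.1 hb).2.symm))
  calc I.card ≤ (2 * c ^ 2 + 3 * c + 2) * (I.image fun m => D m ∩ S).card := h2
    _ ≤ (2 * c ^ 2 + 3 * c + 2) * (4 * S.ncard) := Nat.mul_le_mul_left _ h1
    _ = _ := mul_comm _ _

/-- A cut sequence is short. -/
theorem length_le (h : G.IsCutSeq (S ∪ T) t c q' Φ W N) (hG : G.IsFinConnected)
    (hrep : G.IsReplacing S T t q c Φ) (htq : t ≤ q) (hqq' : q ≤ q') (h2t : 2 * t ≤ q')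
    (hSV : S ⊆ V(G)) : N ≤ S.ncard * (8 * c ^ 2 + 21 * c + 14) := by
  classical
  have h1 := h.card_le_of_disjoint hG hrep htq hqq' hSV
    ((Finset.range N).filter fun m => W m ∩ S = ∅)
    (fun m hm => Finset.mem_range.1 (Finset.mem_filter.1 hm).1)
    (fun m hm => (Finset.mem_filter.1 hm).2)
  have h2 : (((Finset.range N).filter fun m => ¬W m ∩ S = ∅).filter fun m => S ⊆ W m).card
      ≤ 2 * S.ncard * (3 * c + 2) := by
    rcases S.eq_empty_or_nonempty with rfl | hSne
    · simp
    have := h.card_le_of_superset hG hrep htq hqq' h2t hSV hSne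
      (((Finset.range N).filter fun m => ¬W m ∩ S = ∅).filter fun m => S ⊆ W m)
      (fun m hm => Finset.mem_range.1 (Finset.mem_filter.1 (Finset.mem_filter.1 hm).1).1)
      (fun m hm => (Finset.mem_filter.1 hm).2)
    -- As `S` is nonempty, the additional `3c + 2` is at most `|S|(3c + 2)`.
    have hpos := (Set.ncard_pos (hG.finite_of_subset hSV)).2 hSne
    nlinarith
  have h3 := h.card_le_of_separating hG hrep htq hqq' hSV
    (((Finset.range N).filter fun m => ¬W m ∩ S = ∅).filter fun m => ¬S ⊆ W m)
    (fun m hm => Finset.mem_range.1 (Finset.mem_filter.1 (Finset.mem_filter.1 hm).1).1)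
    (fun m hm => ⟨Set.nonempty_iff_ne_empty.2 (Finset.mem_filter.1 (Finset.mem_filter.1 hm).1).2,
      (Finset.mem_filter.1 hm).2⟩)
  have h4 := Finset.card_filter_add_card_filter_not (s := Finset.range N) (fun m => W m ∩ S = ∅)
  have h5 := Finset.card_filter_add_card_filter_not
    (s := (Finset.range N).filter fun m => ¬W m ∩ S = ∅) (fun m => S ⊆ W m)
  rw [Finset.card_range] at h4
  nlinarith

end IsCutSeq

/-! ### Clusters of a set of edges -/

/-- The vertices that are not separated from `x` by a cut contained in `Φ`. -/
def cluster (G : Graph α β) (Φ : Set β) (x : α) : Set α :=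
  {y ∈ V(G) | ∀ Y, G.cutSet Y ⊆ Φ → (x ∈ Y ↔ y ∈ Y)}

theorem mem_cluster_self {x : α} (hx : x ∈ V(G)) : x ∈ G.cluster Φ x :=
  ⟨hx, fun _ _ => Iff.rfl⟩

theorem cluster_eq_of_mem {x y : α} (h : y ∈ G.cluster Φ x) : G.cluster Φ x = G.cluster Φ y := by
  ext z
  exact and_congr_right fun _ => forall₂_congr fun Y hY => by rw [h.2 Y hY]

theorem IsLink.mem_cluster {e : β} {x y : α} (h : G.IsLink e x y) (he : e ∉ Φ) :
    y ∈ G.cluster Φ x := by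
  refine ⟨h.right_mem, fun Y hY => ?_⟩
  have := mt (@hY e) he
  rw [h.mem_cutSet_iff] at this
  tauto

theorem isVertexPartition_cluster (G : Graph α β) (Φ : Set β) :
    G.IsVertexPartition {P | ∃ x ∈ V(G), P = G.cluster Φ x} := by
  refine ⟨?_, ?_, ?_⟩
  · rintro ⟨x, hx, h0⟩
    exact (h0 ▸ mem_cluster_self hx : x ∈ (∅ : Set α))
  · rintro _ ⟨x, -, rfl⟩ _ ⟨y, -, rfl⟩ hne
    refine Set.disjoint_left.2 fun z hz hz' => hne ?_
    rw [cluster_eq_of_mem hz, cluster_eq_of_mem hz']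
  · ext z
    constructor
    · rintro ⟨_, ⟨x, -, rfl⟩, hz⟩
      exact hz.1
    · exact fun hz => ⟨_, ⟨z, hz, rfl⟩, mem_cluster_self hz⟩

/-- Edges outside `Φ` never leave a cluster, so the vertices reachable from `a` within it have their
cut in `Φ`. Such a cut cannot separate `a` from `b`. -/
theorem isConnected_induce_cluster {x : α} (hx : x ∈ V(G)) :
    (G.induce (G.cluster Φ x)).IsConnected := by
  refine ⟨⟨x, mem_cluster_self hx⟩, fun a ha b hb => ?_⟩
  have ha : a ∈ G.cluster Φ x := ha
  have hb : b ∈ G.cluster Φ x := hb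
  have hab : b ∈ G.cluster Φ a := cluster_eq_of_mem ha ▸ hb
  refine ((hab.2 {z | z ∈ G.cluster Φ x ∧
    Relation.ReflTransGen (G.induce (G.cluster Φ x)).Adj a z} ?_).1
      ⟨ha, Relation.ReflTransGen.refl⟩).2
  refine cutSet_subset_of_isLink fun e u v hl hu hv => ?_
  by_contra he
  have hvx : v ∈ G.cluster Φ x := by
    rw [cluster_eq_of_mem hu.1]
    exact hl.mem_cluster he
  exact hv ⟨hvx, hu.2.tail ⟨e, hl, hu.1, hvx⟩⟩

/-- If every edge of `Φ` lies in a cut contained in `Φ`, then `Φ` is the set of edges between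
different clusters. -/
theorem interclusterEdges_cluster
    (hΦ : ∀ e ∈ Φ, ∃ Y, e ∈ G.cutSet Y ∧ G.cutSet Y ⊆ Φ) :
    G.interclusterEdges {P | ∃ x ∈ V(G), P = G.cluster Φ x} = Φ := by
  ext e
  constructor
  · rintro ⟨x, y, hl, _, ⟨u, -, rfl⟩, _, ⟨v, -, rfl⟩, hne, hx, hy⟩
    by_contra he
    rw [cluster_eq_of_mem hx, cluster_eq_of_mem hy] at hne
    exact hne (cluster_eq_of_mem (hl.mem_cluster he))
  · intro he
    obtain ⟨Y, ⟨x, y, hl, hx, hy⟩, hYΦ⟩ := hΦ e he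
    refine ⟨x, y, hl, _, ⟨x, hl.left_mem, rfl⟩, _, ⟨y, hl.right_mem, rfl⟩, fun heq => hy ?_,
      mem_cluster_self hl.left_mem, mem_cluster_self hl.right_mem⟩
    have : y ∈ G.cluster Φ x := heq ▸ mem_cluster_self hl.right_mem
    exact (this.2 Y hYΦ).1 hx

/-- If all candidates can be improved with respect to `Φ`, then `Φ` is an `IA` set. -/
theorem isIASetOfConnected_of_isImprovable (hG : G.IsFinConnected) (hKV : K ⊆ V(G)) {r : ℕ}
    (hΦ : ∀ e ∈ Φ, ∃ Y, e ∈ G.cutSet Y ∧ G.cutSet Y ⊆ Φ)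
    (himp : ∀ X, G.IsCandidate K t c X → G.IsImprovable K r Φ X) :
    G.IsIASetOfConnected K t (r + t) c 1 Φ := by
  refine ⟨_, isVertexPartition_cluster G Φ, ?_, (interclusterEdges_cluster hΦ).symm, ?_⟩
  · rintro _ ⟨x, hx, rfl⟩
    exact isConnected_induce_cluster hx
  rintro T' hT' hT'ne a hac ⟨X, ⟨hXV, -, hXt, hXK, -⟩, hXa⟩
  have hcomp : ∀ B, K ∩ B = T' → K ∩ (V(G) \ B) = K \ T' := by
    rintro B rfl
    ext x
    have := @hKV x
    simp only [Set.mem_inter_iff, Set.mem_sdiff]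
    tauto
  rcases (G.cutSet X).eq_empty_or_nonempty with h0 | hne
  · refine ⟨X, ⟨hXV, hXa.le, by omega, hXK, hcomp X hXK⟩, fun P _ => ?_⟩
    rw [h0, Set.empty_inter, Set.ncard_empty]
    exact Nat.zero_le _
  obtain ⟨B, hBV, hBK, hBc, hBle, hBor⟩ :=
    himp X ⟨hXV, hXt, by rwa [Set.inter_comm, hXK], hne, by omega⟩
  have hKB : K ∩ B = T' := by rw [Set.inter_comm, hBK, Set.inter_comm, hXK]
  refine ⟨B, ⟨hBV, by omega, by omega, hKB, hcomp B hKB⟩, ?_⟩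
  rintro _ ⟨z, hz, rfl⟩
  by_contra hlt
  have hapos := (Set.ncard_pos (hG.finite_cutSet _)).2 hne
  have hBfin := hG.finite_cutSet B
  -- A cluster containing more than `a - 1` edges contains all of `∂(B)`. Then the cut has `a`
  -- edges, misses `Φ` and is coherent, which rules out each kind of improvement.
  have hEq : G.cutSet B ∩ E(G.induce (G.cluster Φ z)) = G.cutSet B :=
    Set.eq_of_subset_of_ncard_le Set.inter_subset_left (by omega) hBfin
  have hin : ∀ ⦃e x y⦄, G.IsLink e x y → x ∈ B → y ∉ B →
      x ∈ G.cluster Φ z ∧ y ∈ G.cluster Φ z := by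
    intro e x y hl hx hy
    have he : e ∈ G.cutSet B ∩ E(G.induce (G.cluster Φ z)) := by
      rw [hEq]
      exact ⟨x, y, hl, hx, hy⟩
    obtain ⟨u, v, hl', hu, hv⟩ := he.2
    rcases hl.eq_and_eq_or_eq_and_eq hl' with ⟨rfl, rfl⟩ | ⟨rfl, rfl⟩
    · exact ⟨hu, hv⟩
    · exact ⟨hv, hu⟩
  rcases hBor with h1 | h1 | h1
  · rw [hEq] at hlt
    omega
  · obtain ⟨e, ⟨x, y, hl, hx, hy⟩, heΦ⟩ := Set.not_disjoint_iff.1 h1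
    obtain ⟨Y, heY, hYΦ⟩ := hΦ e heΦ
    obtain ⟨hxz, hyz⟩ := hin hl hx hy
    have := (hxz.2 Y hYΦ).symm.trans (hyz.2 Y hYΦ)
    rw [hl.mem_cutSet_iff] at heY
    tauto
  · refine h1 fun Y hYΦ => ?_
    by_cases hzY : z ∈ Y
    · refine Or.inl fun e x y hl hx hy => ?_
      obtain ⟨hxz, hyz⟩ := hin hl hx hy
      exact ⟨(hxz.2 Y hYΦ).1 hzY, (hyz.2 Y hYΦ).1 hzY⟩
    · refine Or.inr fun e x y hl hx hy => ?_
      obtain ⟨hxz, hyz⟩ := hin hl hx hy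
      exact ⟨fun h => hzY ((hxz.2 Y hYΦ).2 h), fun h => hzY ((hyz.2 Y hYΦ).2 h)⟩

/-! ### Induced subgraphs -/

theorem IsConnected.isFinConnected (hG : G.IsConnected) (hV : V(G).Finite) (hE : E(G).Finite) :
    G.IsFinConnected := by
  refine ⟨hV, hE, fun Q x y hx hy hxQ hyQ => ?_⟩
  by_contra hne
  have h := hG.2 x hx y hy
  refine hyQ ?_
  clear hy hyQ
  induction h with
  | refl => exact hxQ
  | tail _ hab ih =>
    obtain ⟨e, he⟩ := hab
    by_contra hb
    exact hne ⟨e, _, _, he, ih, hb⟩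

theorem cutSet_induce_subset (G₀ : Graph α β) (V A : Set α) :
    (G₀.induce V).cutSet A ⊆ G₀.cutSet A := by
  rintro e ⟨x, y, hl, hx, hy⟩
  exact ⟨x, y, hl.1, hx, hy⟩

/-- An edge from `D` to the outside of `V` would make its end in `D` a boundary vertex. -/
theorem cutSet_induce_eq {D : Set α} (hD : D ⊆ V) (hdis : Disjoint D (G₀.boundaryVertices V)) :
    (G₀.induce V).cutSet D = G₀.cutSet D := by
  refine (cutSet_induce_subset G₀ V D).antisymm ?_
  rintro e ⟨x, y, hl, hx, hy⟩
  have hyV : y ∈ V := by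
    by_contra hyV
    exact Set.disjoint_left.1 hdis hx ⟨⟨e, ⟨x, y, hl, hD hx, hyV⟩, hl.inc_left⟩, hD hx⟩
  exact ⟨x, y, ⟨hl, hD hx, hyV⟩, hx, hy⟩

/-- An `IA` set replaces small cuts that avoid the boundary of the induced subgraph. -/
theorem IsIASetOfConnected.isReplacing (hF : G₀.IsIASetOfConnected T₀ t q d (2 * c) F)
    (hVfin : V(G₀).Finite) (hE : E(G₀).Finite) (hV : V ⊆ V(G₀)) (hT₀ : T₀ ⊆ V(G₀)) (hcd : 2 * c ≤ d) (hFF' : F ⊆ F') :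
    (G₀.induce V).IsReplacing (G₀.boundaryVertices V) ((T₀ ∩ V) \ G₀.boundaryVertices V) t q c
      (F' ∩ E(G₀.induce V)) := by
  intro D hDV hDS hDt hDc hDT
  have hDV : D ⊆ V := hDV
  rw [cutSet_induce_eq hDV hDS] at hDc ⊢
  obtain ⟨𝓠, ⟨-, -, hcov⟩, -, rfl, hrep⟩ := hF
  obtain ⟨Y, ⟨hYV, hYa, hYq, hYT, -⟩, hY⟩ := hrep (T₀ ∩ D) Set.inter_subset_left (by
      obtain ⟨x, hx, hxT⟩ := hDT
      exact ⟨x, hxT.1.1, hx⟩) _ (hDc.trans hcd)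
    ⟨D, ⟨hDV.trans hV, hDc.trans hcd, hDt, rfl, by
      ext x
      have := @hT₀ x
      simp only [Set.mem_inter_iff, Set.mem_sdiff]
      tauto⟩, rfl⟩
  -- Since `|∂(D)| ≤ 2c`, the truncated difference is zero and no cluster contains an edge of
  -- `∂(Y)`.
  have hYF : G₀.cutSet Y ⊆ G₀.interclusterEdges 𝓠 := by
    rintro e ⟨x, y, hl, hx, hy⟩
    obtain ⟨P, hP, hxP⟩ := hcov.ge hl.left_mem
    obtain ⟨Q, hQ, hyQ⟩ := hcov.ge hl.right_mem
    refine ⟨x, y, hl, P, hP, Q, hQ, fun hPQ => ?_, hxP, hyQ⟩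
    have h0 := hY P hP
    rw [Nat.sub_eq_zero_of_le hDc, Nat.le_zero, Set.ncard_eq_zero
      ((hE.subset (cutSet_subset_edgeSet _ _)).inter_of_left _)] at h0
    exact (h0 ▸ (⟨⟨x, y, hl, hx, hy⟩, x, y, hl, hxP, hPQ ▸ hyQ⟩ :
      e ∈ G₀.cutSet Y ∩ E(G₀.induce P)) : e ∈ (∅ : Set β))
  have hsub : (G₀.induce V).cutSet (Y ∩ V) ⊆ G₀.cutSet Y := by
    rintro e ⟨x, y, ⟨hl, hxV, hyV⟩, hx, hy⟩
    exact ⟨x, y, hl, hx.1, fun hyY => hy ⟨hyY, hyV⟩⟩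
  have hfin := hE.subset (cutSet_subset_edgeSet G₀ Y)
  refine ⟨Y ∩ V, Set.inter_subset_right, ?_, ?_,
    Set.subset_inter (hsub.trans (hYF.trans hFF')) (cutSet_subset_edgeSet _ _),
    (Set.ncard_le_ncard hsub hfin).trans hYa⟩
  · ext x
    have := Set.ext_iff.1 hYT x
    simp only [Set.mem_inter_iff, Set.mem_sdiff] at this ⊢
    tauto
  · exact (Set.ncard_le_ncard Set.inter_subset_left (hVfin.subset hYV)).trans hYq

theorem ncard_cuts_le (hG : G.IsFinConnected) (hW : ∀ l < N, (G.cutSet (W l)).ncard ≤ c) :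
    {e | ∃ l < N, e ∈ G.cutSet (W l)}.ncard ≤ N * c := by
  induction N with
  | zero => simp
  | succ N ih =>
    have hsplit : {e | ∃ l < N + 1, e ∈ G.cutSet (W l)}
        ⊆ {e | ∃ l < N, e ∈ G.cutSet (W l)} ∪ G.cutSet (W N) := by
      rintro e ⟨l, hl, he⟩
      rcases (Nat.lt_succ_iff.1 hl).eq_or_lt with rfl | hl
      · exact Or.inr he
      · exact Or.inl ⟨l, hl, he⟩
    have hfin : {e | ∃ l < N, e ∈ G.cutSet (W l)}.Finite :=
      hG.finite_edgeSet.subset fun e ⟨l, _, he⟩ => cutSet_subset_edgeSet _ _ he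
    have h1 := Set.ncard_le_ncard hsplit (hfin.union (hG.finite_cutSet _))
    have h2 := Set.ncard_union_le {e | ∃ l < N, e ∈ G.cutSet (W l)} (G.cutSet (W N))
    have h3 := ih fun l hl => hW l (by omega)
    have h4 := hW N (by omega)
    rw [Nat.succ_mul]
    omega

/-- The edges between clusters of a partition are covered by cuts consisting of such edges, also
in an induced subgraph. -/
theorem exists_cutSet_of_mem_interclusterEdges {𝓠 : Set (Set α)} (h𝓠 : G₀.IsVertexPartition 𝓠)
    {e : β} (he : e ∈ G₀.interclusterEdges 𝓠) (heV : e ∈ E(G₀.induce V)) :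
    ∃ Y, e ∈ (G₀.induce V).cutSet Y ∧
      (G₀.induce V).cutSet Y ⊆ G₀.interclusterEdges 𝓠 ∩ E(G₀.induce V) := by
  obtain ⟨x, y, hl, P, hP, Q, hQ, hPQ, hx, hy⟩ := he
  obtain ⟨u, v, hl', hu, hv⟩ := heV
  have hyP : y ∉ P := fun hyP => Set.disjoint_left.1 (h𝓠.2.1 hP hQ hPQ) hyP hy
  refine ⟨P, ?_, Set.subset_inter ?_ (cutSet_subset_edgeSet _ _)⟩
  · have hlV : (G₀.induce V).IsLink e u v := ⟨hl', hu, hv⟩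
    rw [hlV.mem_cutSet_iff]
    exact hl'.mem_cutSet_iff.1 ⟨x, y, hl, hx, hyP⟩
  · rintro e' ⟨a, b, hab, ha, hb⟩
    obtain ⟨Q', hQ', hbQ'⟩ := h𝓠.2.2.ge hab.1.right_mem
    exact ⟨a, b, hab.1, P, hP, Q', hQ', fun h => hb (h ▸ hbQ'), ha, hbQ'⟩

end Graph

/-! ### The repair set -/

theorem mainTheorem4 {α β : Type*} (G₀ : Graph α β) (hVfin : V(G₀).Finite) (hEfin : E(G₀).Finite)
    (hG₀ : G₀.IsConnected) (T₀ V : Set α) (hT₀ : T₀ ⊆ V(G₀)) (hV : V ⊆ V(G₀))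
    (hG : (G₀.induce V).IsConnected) (t q q' d c : ℕ) (F F' : Set β)
    (hF : G₀.IsIASet T₀ t q d (2 * c) F)
    (hF' : G₀.IsIASet T₀ t q' d (2 * c + 1) F')
    (hq' : 2 * t ≤ q')
    (hderived : G₀.IsDerivedFrom T₀ d q' (2 * c + 1) F' q (2 * c) F) :
    ∃ R : Set β, G₀.IsRepairSet T₀ V t q' c F' R ∧
      R.ncard ≤ (G₀.boundaryVertices V).ncard * (24 * c ^ 3 + 24 * c ^ 2 + 4 * c) := by
  obtain ⟨⟨hc, hcd, ht, htq⟩, hFc⟩ := (hG₀.isIASet_iff hT₀ _ _ _ _ _).1 hF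
  obtain ⟨-, 𝓠, h𝓠, -, hF'eq, -⟩ := (hG₀.isIASet_iff hT₀ _ _ _ _ _).1 hF'
  obtain ⟨hqq', -, hFF', -⟩ := hderived
  have hqq' : q ≤ q' := (Nat.le_mul_of_pos_right q d.succ_pos).trans hqq'
  set G := G₀.induce V with hGdef
  set S := G₀.boundaryVertices V with hSdef
  have hEG : E(G) ⊆ E(G₀) := by
    rintro e ⟨x, y, hl, -, -⟩
    exact hl.edge_mem
  have hGc : G.IsFinConnected := hG.isFinConnected (hVfin.subset hV) (hEfin.subset hEG)
  have hrep := hFc.isReplacing hVfin hEfin hV hT₀ hcd hFF'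
  have hSV : S ⊆ V(G) := Set.inter_subset_right
  have hKV : S ∪ (T₀ ∩ V) \ S ⊆ V(G) :=
    Set.union_subset hSV (Set.sdiff_subset.trans Set.inter_subset_right)
  -- One round more than the length bound is allowed, so the process must have stopped because all
  -- candidates are improvable.
  obtain ⟨W, M, -, hW, hM⟩ := Graph.exists_isGreedy G (S ∪ (T₀ ∩ V) \ S) t c q' (F' ∩ E(G))
    (S.ncard * (8 * c ^ 2 + 21 * c + 14) + 1)
  have hWs := hW.isCutSeq hGc
  have hMle := hWs.length_le hGc hrep htq hqq' hq' hSV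
  have himp := hM.resolve_left (by omega)
  refine ⟨{e | ∃ l < M, e ∈ G.cutSet (W l)}, ⟨?_, ?_⟩, ?_⟩
  · rintro e ⟨l, -, he⟩
    exact Graph.cutSet_subset_edgeSet _ _ he
  · rw [hG.isIASet_iff hKV]
    refine ⟨⟨one_pos, by omega, ht, by omega⟩,
      Graph.isIASetOfConnected_of_isImprovable hGc hKV ?_ himp⟩
    rintro e (⟨heF, heE⟩ | ⟨l, hl, he⟩)
    · obtain ⟨Y, heY, hY⟩ := Graph.exists_cutSet_of_mem_interclusterEdges h𝓠 (hF'eq ▸ heF) heE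
      exact ⟨Y, heY, (hF'eq ▸ hY).trans Graph.subset_addCuts⟩
    · exact ⟨W l, he, Graph.cutSet_subset_addCuts hl⟩
  · refine (Graph.ncard_cuts_le hGc fun l hl => (hWs.candidate l hl).ncard_cutSet_le).trans
      ((Nat.mul_le_mul_right c hMle).trans ?_)
    rw [mul_assoc]
    refine Nat.mul_le_mul_left _ ?_
    -- For `c ≥ 1` the claim `(8c² + 21c + 14)c ≤ 24c³ + 24c² + 4c` reduces to `10c ≤ 16c³ + 3c²`.
    have hc1 : 1 ≤ c := by omega
    nlinarith [Nat.mul_le_mul hc1 hc1, Nat.mul_le_mul_right (c * c) hc1,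
      Nat.mul_le_mul_right c hc1]
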